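/- **Setting.** Let $R$ be a regular local ring of dimension $3$ with maximal ideal $\mathfrak m$ (or a polynomial ring in three variables over a field with irrelevant ideal $\mathfrak m$), and let $\mathfrak m=(z_1,z_2,z_3)$. Let $T=(T_{i,j})$ be a skew-symmetric $m\times m$ matrix over $R$, $m$ odd, with zero diagonal and entries in $\mathfrak m$. Let $\mathrm{pf}_{\hat j_1,\dots,\hat j_n}(T)$ be the pfaffian of $T$ with rows and columns $j_1,\dots,j_n$ removed ($0$ if these indices are not distinct), put $y_i=(-1)^{i+1}\mathrm{pf}_{\hat i}(T)$, and assume that $I=(y_1,\dots,y_m)$ has grade $3$ (by Buchsbaum and Eisenbud, these $I$ are the Gorenstein ideals of grade $3$). Let $1\le t\le m$ and $J=y_1\mathfrak m+\dots+y_t\mathfrak m+(y_{t+1},\dots,y_m)$. Choose $c_{i,j,l}\in R$ ($1\le i,j\le m$, $l=1,2,3$) with $$T_{j,i}=\sum_{l=1}^3c_{i,j,l}z_l ,\qquad c_{k,k,l}=0\ \text{ for } 1\le k\le t .$$ **Constants.** Write $(m)\setminus S$ for the increasing word of the elements of $\{1,\dots,m\}\setminus S$, and $\mathrm{sgn}\binom{v}{w}$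 for the sign of the permutation rearranging the word $v$ into $w$. For distinct indices put $$\sigma_{i,j,r}=(-1)^{i+1}\mathrm{sgn}\tbinom{(m)\setminus\{i\}}{j\,r\,(m)\setminus\{i,j,r\}},\qquad \sigma_{i,j,r,h,k}=\mathrm{sgn}\tbinom{(m)\setminus\{i,j,r\}}{k\,h\,(m)\setminus\{i,j,r,k,h\}},$$ and $0$ if the indices are not distinct. For $\alpha<\beta$ in $\{1,2,3\}$, $l\in\{1,2,3\}$, $1\le k\le t$ and $1\le i,j\le m$ put $$d^k_{\alpha,\beta}=\sum_{i,r=1}^m\sigma_{i,k,r}c_{i,k,\beta}c_{r,k,\alpha}\mathrm{pf}_{\hat i,\hat k,\hat r}(T),\qquad d^{k,i,j}_{\alpha,\beta}=\sum_{r=1}^m\sigma_{i,j,r}\sum_{h=1}^m\sigma_{i,j,r,h,k}\,\mathrm{pf}_{\hat i,\hat j,\hat r,\hat h,\hat k}(T)\,c_{r,k,\beta}c_{h,k,\alpha},$$ $$d^{k,i,j,l}_{\alpha,\beta}=z_l\,d^{k,i,j}_{\alpha,\beta}\ (k\ne i),\qquad d^{i,i,j,l}_{\alpha,\beta}=0\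 \text{ if }\{\alpha,\beta,l\}=\{1,2,3\},$$ $$d^{i,i,j,\alpha}_{\alpha,\beta}=\sum_{r=1}^m\sigma_{i,j,r}\mathrm{pf}_{\hat i,\hat j,\hat r}(T)c_{r,i,\beta},\qquad d^{i,i,j,\beta}_{\alpha,\beta}=-\sum_{r=1}^m\sigma_{i,j,r}\mathrm{pf}_{\hat i,\hat j,\hat r}(T)c_{r,i,\alpha}.$$ **The complex.** Let $C_0=R$; let $C_1=F_1'\oplus\bigoplus_{k\le t}G_1^k$ be free on $e_i$ ($t<i\le m$) and $u^k_l$ ($k\le t$, $l\le 3$); let $C_2=F_2\oplus\bigoplus_{k\le t}G_2^k$ be free on $f_i$ ($1\le i\le m$) and $v^k_{1,2},v^k_{1,3},v^k_{2,3}$ ($k\le t$); let $C_3=F_3\oplus\bigoplus_{k\le t}G_3^k$ be free on $g$ and $w^k$ ($k\le t$); and let $$\partial e_i=y_i,\quad \partial u^k_l=-y_kz_l,\quad \partial f_i=\sum_{j=t+1}^mT_{j,i}e_j-\sum_{k=1}^t\sum_{l=1}^3c_{i,k,l}u^k_l,\quad \partial v^k_{\alpha,\beta}=z_\alpha u^k_\beta-z_\beta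 u^k_\alpha,$$ $$\partial g=\sum_{i=1}^my_if_i+\sum_{k=1}^t\sum_{\alpha<\beta}d^k_{\alpha,\beta}v^k_{\alpha,\beta},\qquad \partial w^k=z_3v^k_{1,2}-z_2v^k_{1,3}+z_1v^k_{2,3}.$$ Put $e_i\cdot_Fe_j=\sum_{r=1}^m\sigma_{i,j,r}\,\mathrm{pf}_{\hat i,\hat j,\hat r}(T)\,f_r$ and $e_i\cdot_Ff_j=\delta_{i,j}\,g$. **Theorem.** $(C_\bullet,\partial)$ is a free resolution of $R/J$, and it has an (associative, unital, graded-commutative) DG algebra structure with the following products. (a) For $t+1\le i,j\le m$: $\displaystyle e_i\cdot e_j=e_i\cdot_Fe_j+\sum_{k=1}^t\sum_{\alpha<\beta}d^{k,i,j}_{\alpha,\beta}v^k_{\alpha,\beta}.$ (b) For $1\le i\le t$, $t+1\le j\le m$ and $l=1,2,3$: $\displaystyle e_j\cdot u^i_l=z_l\,e_i\cdot_Fe_j+\sum_{k=1}^t\sum_{\alpha<\beta}d^{k,i,j,l}_{\alpha,\beta}v^k_{\alpha,\beta}.$ (e) For $t+1\le i\le m$: $\displaystyle e_i\cdot f_j=e_i\cdot_Ff_j$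 if $t+1\le j\le m$, and $\displaystyle e_i\cdot f_j=\sum_{r=1}^mc_{r,j,3}\,d^{j,i,r}_{1,2}\,w^j$ if $1\le j\le t$. -/

import Mathlib

universe u

namespace PfTrim

/-! ### Words, pfaffians and signs

Letters are `0, …, m - 1` (elements of `Fin m`) instead of `1, …, m`. -/

/-- The increasing word of all letters that do not occur in `s`. -/
def del {m : ℕ} (s : List (Fin m)) : List (Fin m) :=
  (List.finRange m).filter (fun x => decide (x ∉ s))

/-- The sign of the permutation that rearranges the word `v` into the word `w` (two words with
the same letters, each occurring once): `-1` to the number of pairs of letters whose order is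
reversed. -/
def wordSign {m : ℕ} (v w : List (Fin m)) : ℤ :=
  (-1) ^ ((Finset.univ : Finset (Fin m × Fin m)).filter (fun p =>
    p.1 ∈ v ∧ p.2 ∈ v ∧ v.idxOf p.1 < v.idxOf p.2 ∧ w.idxOf p.2 < w.idxOf p.1)).card

/-- All partitions of the letters of a word into subsets of size two, a partition
`{j₁, j₂}, {j₃, j₄}, …` being recorded as the word `j₁ j₂ j₃ j₄ …`. The first letter is paired with
each of the other letters, and the remaining letters are partitioned recursively. There are none
if the length is odd. -/
def pairings {α : Type*} : List α → List (List α)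
  | [] => [[]]
  | a :: l => (List.finRange l.length).flatMap fun p : Fin l.length =>
      (pairings (l.eraseIdx p)).map fun w => a :: l.get p :: w
termination_by l => l.length
decreasing_by
  have h := List.length_eraseIdx_le l p
  simp only [List.length_cons]
  omega

/-- `T j₁ j₂ * T j₃ j₄ * ⋯` for the word `j₁ j₂ j₃ j₄ …`. -/
def pairProd {R : Type*} [CommRing R] {m : ℕ} (T : Matrix (Fin m) (Fin m) R) : List (Fin m) → R
  | a :: b :: l => T a b * pairProd T l
  | _ => 1

/-- The pfaffian of `T` on a word with distinct letters. -/
def pf {R : Type*} [CommRing R] {m : ℕ} (T : Matrix (Fin m) (Fin m) R) (w : List (Fin m)) : R :=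
  ((pairings w).map fun j => ((wordSign w j : ℤ) : R) * pairProd T j).sum

/-- The pfaffian of `T` with the rows and columns in `s` removed; zero if the indices in `s` are
not distinct. -/
def pfDel {R : Type*} [CommRing R] {m : ℕ} (T : Matrix (Fin m) (Fin m) R) (s : List (Fin m)) : R :=
  if s.Nodup then pf T (del s) else 0

/-- `σ_{i,j,r}`. The factor `(-1)^{i+1}` for an index `i ≥ 1` is `(-1)^i` for indices `i ≥ 0`. -/
def sig3 {m : ℕ} (i j r : Fin m) : ℤ :=
  if [i, j, r].Nodup then (-1) ^ (i : ℕ) * wordSign (del [i]) (j :: r :: del [i, j, r]) else 0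

/-- `σ_{i,j,r,h,k}`. -/
def sig5 {m : ℕ} (i j r h k : Fin m) : ℤ :=
  if [i, j, r, h, k].Nodup then wordSign (del [i, j, r]) (k :: h :: del [i, j, r, k, h]) else 0

/-! ### The ideals -/

/-- `y_i = (-1)^{i+1} pf_{\hat i}(T)` for an index `i ≥ 1`, hence `(-1)^i` for `i ≥ 0`. -/
def gen {R : Type*} [CommRing R] {m : ℕ} (T : Matrix (Fin m) (Fin m) R) (i : Fin m) : R :=
  (-1) ^ (i : ℕ) * pfDel T [i]

/-- The ideal of the submaximal pfaffians. -/
def pfIdeal {R : Type*} [CommRing R] {m : ℕ} (T : Matrix (Fin m) (Fin m) R) : Ideal R :=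
  Ideal.span (Set.range (gen T))

/-- The trimming `y_1 𝔪 + ⋯ + y_t 𝔪 + (y_{t+1}, …, y_m)`. -/
def trimIdeal {R : Type*} [CommRing R] {m : ℕ} (T : Matrix (Fin m) (Fin m) R) (𝔪 : Ideal R)
    (t : ℕ) : Ideal R :=
  (⨆ k : {k : Fin m // (k : ℕ) < t}, Ideal.span {gen T k} * 𝔪) ⊔
    Ideal.span (gen T '' {j : Fin m | t ≤ (j : ℕ)})

/-- The grade of an ideal: the supremum of the lengths of the (weakly) regular sequences in it.
For a proper ideal these are the regular sequences; the unit ideal has grade `⊤`. -/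
noncomputable def idealGrade {R : Type*} [CommRing R] (I : Ideal R) : ℕ∞ :=
  ⨆ rs : {rs : List R // RingTheory.Sequence.IsWeaklyRegular R rs ∧ ∀ r ∈ rs, r ∈ I},
    (rs.1.length : ℕ∞)

/-- `R` is a regular local ring of dimension three with maximal ideal `𝔪`, or a polynomial ring in
three variables over a field with irrelevant ideal `𝔪`. -/
def IsBaseRing {R : Type u} [CommRing R] (𝔪 : Ideal R) : Prop :=
  (∃ _ : IsRegularLocalRing R, ringKrullDim R = 3 ∧ 𝔪 = IsLocalRing.maximalIdeal R) ∨
  (∃ (k : Type u) (_ : Field k) (e : R ≃+* MvPolynomial (Fin 3) k),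
    𝔪 = (Ideal.span (Set.range (MvPolynomial.X : Fin 3 → MvPolynomial (Fin 3) k))).comap e)

/-! ### Graded complexes, free resolutions and DG algebras -/

/-- `A` is the direct sum of its submodules `𝒜 n`, and `d` is a differential of degree `-1`. -/
structure IsGradedComplex {R A : Type*} [CommRing R] [AddCommGroup A] [Module R A]
    (𝒜 : ℕ → Submodule R A) (d : A →ₗ[R] A) : Prop where
  isInternal : DirectSum.IsInternal 𝒜
  d_zero : ∀ x ∈ 𝒜 0, d x = 0
  d_succ : ∀ n, ∀ x ∈ 𝒜 (n + 1), d x ∈ 𝒜 n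
  d_d : ∀ x, d (d x) = 0

/-- The graded complex `(A, d)` is a resolution of `R ⧸ J` by free modules, the isomorphism of
`R ⧸ J` with the homology in degree zero being given by `a ↦ a • one`. -/
structure IsFreeResolution {R A : Type*} [CommRing R] [AddCommGroup A] [Module R A]
    (𝒜 : ℕ → Submodule R A) (d : A →ₗ[R] A) (one : A) (J : Ideal R) : Prop
    extends IsGradedComplex 𝒜 d where
  free : ∀ n, Module.Free R (𝒜 n)
  exact_succ : ∀ n, ∀ x ∈ 𝒜 (n + 1), d x = 0 → ∃ y ∈ 𝒜 (n + 2), d y = x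
  one_mem : one ∈ 𝒜 0
  surjective_zero : ∀ x ∈ 𝒜 0, ∃ a : R, ∃ y ∈ 𝒜 1, x = a • one + d y
  kernel_zero : ∀ a : R, (∃ y ∈ 𝒜 1, d y = a • one) ↔ a ∈ J

/-- `mul` is a product with unit `one` that makes the graded complex `(A, d)` an associative,
graded-commutative (with odd elements squaring to zero) DG algebra. -/
structure IsDGAlgebra {R A : Type*} [CommRing R] [AddCommGroup A] [Module R A]
    (𝒜 : ℕ → Submodule R A) (d : A →ₗ[R] A) (one : A) (mul : A →ₗ[R] A →ₗ[R] A) : Prop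
    extends IsGradedComplex 𝒜 d where
  one_mem : one ∈ 𝒜 0
  mul_mem : ∀ p q, ∀ x ∈ 𝒜 p, ∀ y ∈ 𝒜 q, mul x y ∈ 𝒜 (p + q)
  one_mul : ∀ x, mul one x = x
  mul_one : ∀ x, mul x one = x
  mul_assoc : ∀ x y w, mul (mul x y) w = mul x (mul y w)
  mul_comm : ∀ p q, ∀ x ∈ 𝒜 p, ∀ y ∈ 𝒜 q, mul x y = (-1 : R) ^ (p * q) • mul y x
  mul_self : ∀ p, Odd p → ∀ x ∈ 𝒜 p, mul x x = 0
  leibniz : ∀ p, ∀ x ∈ 𝒜 p, ∀ y, d (mul x y) = mul (d x) y + (-1 : R) ^ p • mul x (d y)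

/-! ### The complex

Superscripts `k = 1, …, t` become elements of `Low m t`, indices `t + 1, …, m` elements of
`High m t`, and pairs `α < β` in `{1, 2, 3}` elements of `Pair`. -/

/-- The first `t` indices. -/
abbrev Low (m t : ℕ) : Type := {k : Fin m // (k : ℕ) < t}

/-- The indices after the first `t`. -/
abbrev High (m t : ℕ) : Type := {i : Fin m // t ≤ (i : ℕ)}

/-- Pairs `α < β` in a set of three elements. -/
abbrev Pair : Type := {p : Fin 3 × Fin 3 // p.1 < p.2}

/-- The basis of the complex: `one` of `R`, `e i` of `F₁'`, `u k l` of `G₁ᵏ`, `f i` of `F₂`,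
`v k (α, β)` of `G₂ᵏ`, `g` of `F₃`, `w k` of `G₃ᵏ`. -/
inductive Cell (m t : ℕ) : Type
  | one : Cell m t
  | e (i : High m t) : Cell m t
  | u (k : Low m t) (l : Fin 3) : Cell m t
  | f (i : Fin m) : Cell m t
  | v (k : Low m t) (p : Pair) : Cell m t
  | g : Cell m t
  | w (k : Low m t) : Cell m t

/-- The homological degree of a basis element. -/
def Cell.deg {m t : ℕ} : Cell m t → ℕ
  | .one => 0
  | .e _ => 1
  | .u _ _ => 1
  | .f _ => 2
  | .v _ _ => 2
  | .g => 3
  | .w _ => 3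

/-- The underlying free module of the complex. -/
abbrev Res (R : Type*) [CommRing R] (m t : ℕ) : Type _ := Cell m t →₀ R

/-- A basis element as an element of the complex. -/
noncomputable def bas (R : Type*) [CommRing R] {m t : ℕ} (b : Cell m t) : Res R m t :=
  Finsupp.single b 1

/-- The homogeneous component of degree `n`. -/
noncomputable def piece (R : Type*) [CommRing R] (m t : ℕ) (n : ℕ) : Submodule R (Res R m t) :=
  Finsupp.supported R R {b : Cell m t | b.deg = n}

section Constants

variable {R : Type*} [CommRing R] {m : ℕ} (T : Matrix (Fin m) (Fin m) R)
  (c : Fin m → Fin m → Fin 3 → R) (z : Fin 3 → R)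

/-- `d^k_{α,β}`. -/
def dOne (k : Fin m) (α β : Fin 3) : R :=
  ∑ i, ∑ r, (sig3 i k r : R) * c i k β * c r k α * pfDel T [i, k, r]

/-- `d^{k,i,j}_{α,β}`. -/
def dThree (k i j : Fin m) (α β : Fin 3) : R :=
  ∑ r, (sig3 i j r : R) *
    ∑ h, (sig5 i j r h k : R) * pfDel T [i, j, r, h, k] * c r k β * c h k α

/-- `d^{k,i,j,l}_{α,β}`, for `α ≠ β`. -/
def dFour (k i j : Fin m) (l α β : Fin 3) : R :=
  if k ≠ i then z l * dThree T c k i j α β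
  else if l = α then ∑ r, (sig3 i j r : R) * pfDel T [i, j, r] * c r i β
  else if l = β then -∑ r, (sig3 i j r : R) * pfDel T [i, j, r] * c r i α
  else 0

/-- The differential: `∂₁`, `∂₂`, `∂₃` on basis elements. -/
noncomputable def diff (t : ℕ) : Res R m t →ₗ[R] Res R m t :=
  Finsupp.linearCombination R fun b : Cell m t => match b with
    | .one => 0
    | .e i => gen T i • bas R .one
    | .u k l => -(gen T k * z l) • bas R .one
    | .f i => ∑ j : High m t, T j i • bas R (.e j)
        - ∑ k : Low m t, ∑ l : Fin 3, c i k l • bas R (.u k l)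
    | .v k p => z p.1.1 • bas R (.u k p.1.2) - z p.1.2 • bas R (.u k p.1.1)
    | .g => ∑ i : Fin m, gen T i • bas R (.f i)
        + ∑ k : Low m t, ∑ p : Pair, dOne T c k p.1.1 p.1.2 • bas R (.v k p)
    | .w k => z 2 • bas R (.v k ⟨(0, 1), by decide⟩) - z 1 • bas R (.v k ⟨(0, 2), by decide⟩)
        + z 0 • bas R (.v k ⟨(1, 2), by decide⟩)

/-- The product `e_i ·_F e_j` in the resolution of the pfaffian ideal, an element of `F₂`. -/
noncomputable def prodEE (t : ℕ) (i j : Fin m) : Res R m t :=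
  ∑ r : Fin m, ((sig3 i j r : R) * pfDel T [i, j, r]) • bas R (.f r)

end Constants

/-- The product `e_i ·_F f_j = δ_{i,j} g` in the resolution of the pfaffian ideal. -/
noncomputable def prodEF (R : Type*) [CommRing R] {m : ℕ} (t : ℕ) (i j : Fin m) : Res R m t :=
  if i = j then bas R .g else 0

end PfTrim

open PfTrim

/-! Let pf be the linear functional on the exterior algebra of R^m that takes a word of basis
vectors to the pfaffian of T on that word. Expansion along the first row reads pf(e_q ∧ x) = pf(T_q
⌟ x), where T_q is the q-th row. Contracting the top form with vectors a₁, …, a_n and applying pf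
gives `coPf`, which is multilinear and alternating; on basis vectors it is a signed pfaffian with
rows and columns removed. The y_i, the coefficients of e_i ·_F e_j and the constants d are, up to
sign and factors z_l, values of `coPf`, some arguments being the vectors (c_{r,k,l})_r. Since e_q
annihilates the top form, `coPf` with first argument T_q expands into shorter values
(`coPf_row_one`, `coPf_row_three`, `coPf_row_five`). As T_k = ∑ z_l c_{·,k,l}, this relation carries
the identities behind ∂² = 0 and the product formulas; c_{k,k,l} = 0 removes the unwanted terms.

Exactness. The product e_i ·_F makes multiplication by y_i null-homotopic on the complex with maps
y, T, y. Together with a regular triple in I this gives exactness (`exists_mulVec_eq`,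
`exists_smul_of_mulVec_eq_zero`). The Koszul complex on z is the case m = 3, and it is exact too
since I ⊆ 𝔪. The map u^k_l ↦ -z_l e_k compares C with the pfaffian resolution: a cycle is first
treated there, and what remains is a Koszul cycle in each block k.

Products. The complex has length three, so ∂₃ is injective. Any alternating choice of products in
degree one with the right boundaries extends to a DG algebra (`exists_isDGAlgebra`): products of
degrees one and two are lifted by exactness, and the identities that are not formal live in degree
three, where they may be checked after applying ∂. Formulas (a) and (b) are such a choice. Formula
(e) is then forced, because its right side has the boundary that the Leibniz rule demands
(`diff_mulEF`). -/

namespace PfTrim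

/-! ### The pfaffian functional on the exterior algebra; words and signs -/

section Pfaffian

variable {R : Type*} [CommRing R]

/-- The Pfaffian of an alternating bilinear form, as a linear functional on the exterior algebra. -/
noncomputable def pfForm {M : Type*} [AddCommGroup M] [Module R M] (B : LinearMap.BilinForm R M)
    (h : B.toQuadraticMap = (0 : QuadraticForm R M) - 0) : ExteriorAlgebra R M →ₗ[R] R :=
  ExteriorAlgebra.algebraMapInv.toLinearMap ∘ₗ CliffordAlgebra.changeForm h

lemma pfForm_one {M : Type*} [AddCommGroup M] [Module R M] (B : LinearMap.BilinForm R M)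
    (h : B.toQuadraticMap = (0 : QuadraticForm R M) - 0) : pfForm B h 1 = 1 := by
  simp [pfForm]

lemma algebraMapInv_ι_mul {M : Type*} [AddCommGroup M] [Module R M]
    (v : M) (x : ExteriorAlgebra R M) :
    ExteriorAlgebra.algebraMapInv (R := R) (ExteriorAlgebra.ι R v * x) = 0 := by
  simp [ExteriorAlgebra.algebraMapInv]

/-- Changing the form turns multiplication by v into multiplication by v minus contraction with B v,
and a multiple of v has no scalar part. -/
lemma pfForm_ι_mul {M : Type*} [AddCommGroup M] [Module R M] (B : LinearMap.BilinForm R M)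
    (h : B.toQuadraticMap = (0 : QuadraticForm R M) - 0) (v : M) (x : ExteriorAlgebra R M) :
    pfForm B h (ExteriorAlgebra.ι R v * x) =
      -pfForm B h (CliffordAlgebra.contractLeft (B v) x) := by
  have h1 := CliffordAlgebra.changeForm_ι_mul h v x
  simp only [pfForm, LinearMap.comp_apply, CliffordAlgebra.changeForm_contractLeft]
  erw [h1]
  rw [map_sub]
  erw [algebraMapInv_ι_mul]
  simp

variable {m : ℕ}

/-- The product of the basis vectors indexed by a word. -/
noncomputable def wordForm (R : Type*) [CommRing R] {m : ℕ} (w : List (Fin m)) :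
    ExteriorAlgebra R (Fin m → R) :=
  (w.map fun i => ExteriorAlgebra.ι R (Pi.single i 1 : Fin m → R)).prod

/-- Contraction with a coordinate function. -/
noncomputable def contract (R : Type*) [CommRing R] {m : ℕ} (i : Fin m) :
    ExteriorAlgebra R (Fin m → R) →ₗ[R] ExteriorAlgebra R (Fin m → R) :=
  CliffordAlgebra.contractLeft (LinearMap.proj i : Module.Dual R (Fin m → R))

lemma wordForm_nil : wordForm R ([] : List (Fin m)) = 1 := rfl

lemma wordForm_cons (a : Fin m) (w : List (Fin m)) :
    wordForm R (a :: w) = ExteriorAlgebra.ι R (Pi.single a 1) * wordForm R w := by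
  simp [wordForm]

lemma contract_ι_mul (i : Fin m) (v : Fin m → R) (x : ExteriorAlgebra R (Fin m → R)) :
    contract R i (ExteriorAlgebra.ι R v * x) = v i • x - ExteriorAlgebra.ι R v * contract R i x :=
  CliffordAlgebra.contractLeft_ι_mul _ _ _

lemma contract_wordForm_of_notMem (i : Fin m) (w : List (Fin m)) (h : i ∉ w) :
    contract R i (wordForm R w) = 0 := by
  induction w with
  | nil => exact CliffordAlgebra.contractLeft_one _ _
  | cons a w ih =>
    simp only [List.mem_cons, not_or] at h
    rw [wordForm_cons, contract_ι_mul, ih h.2, Pi.single_eq_of_ne h.1]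
    simp

lemma contract_wordForm_cons_self (a : Fin m) (w : List (Fin m)) (h : a ∉ w) :
    contract R a (wordForm R (a :: w)) = wordForm R w := by
  rw [wordForm_cons, contract_ι_mul, contract_wordForm_of_notMem a w h]
  simp

lemma wordForm_eq_cons_erase (i : Fin m) (w : List (Fin m)) (h : i ∈ w) :
    wordForm R w = (-1 : R) ^ w.idxOf i • wordForm R (i :: w.erase i) := by
  induction w with
  | nil => simp at h
  | cons a w ih =>
    by_cases hai : a = i
    · subst hai; simp
    · have h' : i ∈ w := by
        rcases List.mem_cons.1 h with h | h
        · exact absurd h.symm hai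
        · exact h
      rw [List.erase_cons_tail (by simpa using hai), List.idxOf_cons_ne _ hai, wordForm_cons, ih h',
        wordForm_cons, wordForm_cons, wordForm_cons, mul_smul_comm, ← mul_assoc,
        ← mul_assoc, pow_succ]
      have := CliffordAlgebra.ι_mul_ι_comm_of_isOrtho (Q := (0 : QuadraticForm R (Fin m → R)))
        (a := Pi.single a 1) (b := Pi.single i 1) (by simp [QuadraticMap.IsOrtho])
      erw [this]
      simp [ExteriorAlgebra.ι]

lemma ι_mul_wordForm_of_mem (i : Fin m) (w : List (Fin m)) (h : i ∈ w) :
    ExteriorAlgebra.ι R (Pi.single i 1) * wordForm R w = 0 := by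
  rw [wordForm_eq_cons_erase i w h, wordForm_cons, mul_smul_comm, ← mul_assoc,
    ExteriorAlgebra.ι_sq_zero, zero_mul, smul_zero]

lemma idxOf_erase_lt_iff (v : List (Fin m)) {b x y : Fin m} (hx : x ≠ b) (hy : y ≠ b) :
    (v.erase b).idxOf x < (v.erase b).idxOf y ↔ v.idxOf x < v.idxOf y := by
  induction v with
  | nil => simp
  | cons a v ih =>
    by_cases hab : a = b
    · subst hab
      simp [List.idxOf_cons_ne _ hx.symm, List.idxOf_cons_ne _ hy.symm]
    · rw [List.erase_cons_tail (by simpa using hab)]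
      by_cases hax : a = x <;> by_cases hay : a = y <;>
        simp_all

lemma card_idxOf_lt (v : List (Fin m)) (hv : v.Nodup) (b : Fin m) :
    (Finset.univ.filter fun x => x ∈ v ∧ v.idxOf x < v.idxOf b).card = v.idxOf b := by
  have h : (Finset.univ.filter fun x => x ∈ v ∧ v.idxOf x < v.idxOf b)
      = (v.take (v.idxOf b)).toFinset := by
    ext x
    simp only [Finset.mem_filter, Finset.mem_univ, true_and, List.mem_toFinset]
    constructor
    · rintro ⟨h1, h2⟩
      exact (List.mem_take_iff_idxOf_lt h1).2 h2
    · intro h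
      have h1 := List.mem_of_mem_take h
      exact ⟨h1, (List.mem_take_iff_idxOf_lt h1).1 h⟩
  rw [h, List.toFinset_card_of_nodup (hv.sublist (List.take_sublist _ _)), List.length_take,
    min_eq_left List.idxOf_le_length]

/-- Count inversions: those involving b come from the letters preceding b in v, and the others are
the inversions of the words without b. -/
lemma wordSign_cons (v w : List (Fin m)) (hv : v.Nodup) (b : Fin m) (hb : b ∈ v)
    (hw : w.Perm (v.erase b)) :
    wordSign v (b :: w) = (-1) ^ v.idxOf b * wordSign (v.erase b) w := by
  have hbw : b ∉ w := fun h => (hv.not_mem_erase (hw.subset h))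
  unfold wordSign
  rw [← pow_add]
  congr 1
  rw [← Finset.card_filter_add_card_filter_not (fun p : Fin m × Fin m => p.2 = b)]
  congr 1
  · conv_rhs => rw [← card_idxOf_lt v hv b]
    refine Finset.card_bij (fun p _ => p.1) ?_ ?_ ?_
    · rintro ⟨x, y⟩ h
      simp only [Finset.mem_filter, Finset.mem_univ, true_and] at h ⊢
      obtain ⟨⟨h1, h2, h3, h4⟩, rfl⟩ := h
      exact ⟨h1, h3⟩
    · rintro ⟨x, y⟩ h ⟨x', y'⟩ h' heq
      simp only [Finset.mem_filter, Finset.mem_univ, true_and] at h h' heq ⊢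
      rw [heq, h.2, h'.2]
    · intro x h
      simp only [Finset.mem_filter, Finset.mem_univ, true_and] at h
      refine ⟨(x, b), ?_, rfl⟩
      have : b ≠ x := by rintro rfl; simp at h
      simp only [Finset.mem_filter, Finset.mem_univ, true_and]
      simp [h, hb, List.idxOf_cons_ne _ this]
  · rw [Finset.filter_filter]
    congr 1
    ext ⟨x, y⟩
    simp only [Finset.mem_filter, Finset.mem_univ, true_and]
    by_cases hy : y = b
    · subst hy
      simp [hv.not_mem_erase]
    by_cases hx : x = b
    · subst hx
      simp [hv.not_mem_erase]
    rw [idxOf_erase_lt_iff v hx hy, List.idxOf_cons_ne _ (Ne.symm hx),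
      List.idxOf_cons_ne _ (Ne.symm hy), List.mem_erase_of_ne hx, List.mem_erase_of_ne hy]
    simp [hy]

lemma perm_of_mem_pairings (n : ℕ) :
    ∀ w : List (Fin m), w.length = n → ∀ j ∈ pairings w, j.Perm w := by
  induction n using Nat.strong_induction_on with
  | _ n ih =>
  intro w hw j hj
  cases w with
  | nil => simp [pairings] at hj; simp [hj]
  | cons a l =>
    rw [pairings] at hj
    simp only [List.mem_flatMap, List.mem_map] at hj
    obtain ⟨p, -, q, hq, rfl⟩ := hj
    have := ih (l.eraseIdx p).length (by
      have := List.length_eraseIdx_le l p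
      simp only [List.length_cons] at hw
      omega) _ rfl q hq
    refine List.Perm.cons _ ((this.cons _).trans ?_)
    exact List.getElem_cons_eraseIdx_perm p.2

/-- Links the inversion count to anticommutativity: bringing the first letter of w to the front of v
costs exactly the sign split off by `wordSign_cons`. -/
lemma wordForm_eq_wordSign_smul (v w : List (Fin m)) (hv : v.Nodup) (h : w.Perm v) :
    wordForm R v = ((wordSign v w : ℤ) : R) • wordForm R w := by
  induction w generalizing v with
  | nil =>
    obtain rfl := List.nil_perm.1 h
    simp [wordSign]
  | cons b w ih =>
    have hb : b ∈ v := h.subset (by simp)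
    have hw : w.Perm (v.erase b) := by simpa using h.erase b
    rw [wordForm_eq_cons_erase b v hb, wordForm_cons, ih _ (hv.erase b) hw,
      wordSign_cons v w hv b hb hw, wordForm_cons, mul_smul_comm, smul_smul]
    push_cast
    rfl

end Pfaffian

/-! ### Pfaffians of words, and pfaffians of contractions of the top form -/

section
variable {R : Type*} [CommRing R] {m : ℕ}

/-- The minus sign cancels the one in `pfForm_ι_mul`, so that expansion along row a has coefficients
T a i. -/
lemma toQuadraticMap_neg_toBilin' (T : Matrix (Fin m) (Fin m) R)
    (hskew : ∀ i j, T j i = -T i j) (hdiag : ∀ i, T i i = 0) :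
    (-Matrix.toBilin' T).toQuadraticMap = (0 : QuadraticForm R (Fin m → R)) - 0 := by
  ext v
  simp only [LinearMap.BilinMap.toQuadraticMap_apply, sub_zero, zero_apply,
    LinearMap.neg_apply, Matrix.toBilin'_apply, neg_eq_zero]
  rw [← Fintype.sum_prod_type' (f := fun i j => v i * T i j * v j)]
  -- Terms at (i, j) and (j, i) cancel and diagonal terms vanish; the involution avoids dividing by
  -- 2.
  refine Finset.sum_involution (fun p _ => p.swap) ?_ ?_ ?_ ?_
  · rintro ⟨i, j⟩ -
    simp only [Prod.swap_prod_mk]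
    rw [hskew i j]
    ring
  · rintro ⟨i, j⟩ - h heq
    simp only [Prod.swap_prod_mk, Prod.mk.injEq] at heq
    obtain ⟨rfl, -⟩ := heq
    exact h (by simp [hdiag])
  · intros; simp
  · intros; simp

/-- Contraction with the linear form whose coefficients are the entries of a vector. -/
noncomputable def contractVec (f : Fin m → R) :
    ExteriorAlgebra R (Fin m → R) →ₗ[R] ExteriorAlgebra R (Fin m → R) :=
  CliffordAlgebra.contractLeft (dotProductEquiv R (Fin m) f)

lemma contractVec_sum_smul {ι : Type*} (s : Finset ι) (a : ι → R) (f : ι → Fin m → R)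
    (x : ExteriorAlgebra R (Fin m → R)) :
    contractVec (∑ i ∈ s, a i • f i) x = ∑ i ∈ s, a i • contractVec (f i) x := by
  simp only [contractVec, map_sum, map_smul, LinearMap.sum_apply, LinearMap.smul_apply]

lemma contractVec_single (i : Fin m) : contractVec (Pi.single i 1) = contract R i := by
  unfold contractVec contract
  congr 1
  ext v
  simp [Pi.single_apply, eq_comm]

lemma contractVec_ι_mul (f v : Fin m → R) (x : ExteriorAlgebra R (Fin m → R)) :
    contractVec f (ExteriorAlgebra.ι R v * x) =
      (f ⬝ᵥ v) • x - ExteriorAlgebra.ι R v * contractVec f x :=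
  CliffordAlgebra.contractLeft_ι_mul _ _ _

lemma contractVec_contractVec (f : Fin m → R) (x : ExteriorAlgebra R (Fin m → R)) :
    contractVec f (contractVec f x) = 0 :=
  CliffordAlgebra.contractLeft_contractLeft _ _

lemma contractVec_comm (f g : Fin m → R) (x : ExteriorAlgebra R (Fin m → R)) :
    contractVec f (contractVec g x) = -contractVec g (contractVec f x) :=
  CliffordAlgebra.contractLeft_comm _ _ _

lemma neg_toBilin'_single (T : Matrix (Fin m) (Fin m) R) (a : Fin m) :
    (-Matrix.toBilin' T) (Pi.single a 1) = -dotProductEquiv R (Fin m) (T a) := by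
  apply LinearMap.ext
  intro v
  simp [Matrix.toBilin'_apply, Pi.single_apply, dotProduct]

lemma sum_smul_single_one (f : Fin m → R) : ∑ i, f i • (Pi.single i 1 : Fin m → R) = f := by
  ext j
  simp [Pi.single_apply]

/-- The Pfaffian of an alternating matrix as a linear functional on the exterior algebra. -/
noncomputable def pfFun (T : Matrix (Fin m) (Fin m) R)
    (hskew : ∀ i j, T j i = -T i j) (hdiag : ∀ i, T i i = 0) :
    ExteriorAlgebra R (Fin m → R) →ₗ[R] R :=
  pfForm _ (toQuadraticMap_neg_toBilin' T hskew hdiag)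

variable (T : Matrix (Fin m) (Fin m) R) (hskew : ∀ i j, T j i = -T i j) (hdiag : ∀ i, T i i = 0)

lemma pfFun_single_mul (a : Fin m) (x : ExteriorAlgebra R (Fin m → R)) :
    pfFun T hskew hdiag (ExteriorAlgebra.ι R (Pi.single a 1) * x) =
      pfFun T hskew hdiag (contractVec (T a) x) := by
  rw [pfFun, pfForm_ι_mul, neg_toBilin'_single, map_neg, LinearMap.neg_apply, map_neg, neg_neg,
    contractVec]

lemma pfFun_single_mul_eq_sum (a : Fin m) (x : ExteriorAlgebra R (Fin m → R)) :
    pfFun T hskew hdiag (ExteriorAlgebra.ι R (Pi.single a 1) * x) =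
      ∑ i, T a i * pfFun T hskew hdiag (contract R i x) := by
  rw [pfFun_single_mul]
  conv_lhs => rw [← sum_smul_single_one (T a), contractVec_sum_smul, map_sum]
  simp [contractVec_single]

lemma contract_wordForm (i : Fin m) (w : List (Fin m)) (hw : w.Nodup) (h : i ∈ w) :
    contract R i (wordForm R w) = (-1 : R) ^ w.idxOf i • wordForm R (w.erase i) := by
  conv_lhs => rw [wordForm_eq_cons_erase i w h]
  rw [map_smul, contract_wordForm_cons_self _ _ hw.not_mem_erase]

lemma sum_eq_sum_finRange_get {M : Type*} [AddCommMonoid M] (f : Fin m → M)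
    (l : List (Fin m)) (hl : l.Nodup)
    (hf : ∀ i ∉ l, f i = 0) :
    ∑ i, f i = ((List.finRange l.length).map fun p => f (l.get p)).sum := by
  have h1 : ((List.finRange l.length).map fun p => f (l.get p)) = l.map f := by
    conv_rhs => rw [← List.map_get_finRange l]
    rw [List.map_map]
    rfl
  rw [h1, ← List.sum_toFinset f hl]
  symm
  apply Finset.sum_subset (Finset.subset_univ _)
  intro i _ hi
  exact hf i (by simpa using hi)

/-- Both sides satisfy the same recursion. Pairing the first letter with the one at position p of
the rest gives the sign (-1)^p, by `wordSign_cons` on one side and by contracting that letter away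
on the other. -/
lemma pf_eq_pfFun (n : ℕ) : ∀ w : List (Fin m), w.length = n → w.Nodup →
    pf T w = pfFun T hskew hdiag (wordForm R w) := by
  induction n using Nat.strong_induction_on with
  | _ n ih =>
  intro w hwn hw
  cases w with
  | nil => simp [pf, pairings, wordSign, pairProd, wordForm_nil, pfFun, pfForm_one]
  | cons a l =>
    have hl := (List.nodup_cons.1 hw).2
    rw [wordForm_cons, pfFun_single_mul_eq_sum, sum_eq_sum_finRange_get _ l hl
      (fun i hi => by rw [contract_wordForm_of_notMem i l hi]; simp), pf, pairings,
      List.map_flatMap,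
      List.flatMap, List.sum_flatten, List.map_map]
    congr 1
    refine List.map_congr_left fun p _ => ?_
    have hmem : l.get p ∈ l := List.get_mem _ _
    have hidx : l.idxOf (l.get p) = p := List.Nodup.idxOf_getElem hl p p.2
    have her : l.eraseIdx p = l.erase (l.get p) := by
      rw [List.erase_eq_eraseIdx_of_idxOf hidx]
    rw [contract_wordForm _ _ hl hmem, ← her, map_smul, ← ih (l.eraseIdx p).length (by
        have := List.length_eraseIdx_le l p
        simp only [List.length_cons] at hwn
        omega) _ rfl (hl.sublist (List.eraseIdx_sublist _ _))]
    simp only [Function.comp, List.map_map, pf, smul_eq_mul]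
    rw [← List.sum_map_mul_left, ← List.sum_map_mul_left]
    congr 1
    refine List.map_congr_left fun q hq => ?_
    have hq' := perm_of_mem_pairings _ _ rfl _ hq
    rw [her] at hq'
    have hp : (l.get p :: q).Perm l := (hq'.cons _).trans (List.perm_cons_erase hmem).symm
    simp only [Function.comp, pairProd]
    rw [wordSign_cons (a :: l) _ hw a (by simp) (by simpa using hp)]
    simp only [List.idxOf_cons_self, List.erase_cons_head, pow_zero, one_mul]
    rw [wordSign_cons l _ hl _ hmem hq', hidx, her]
    push_cast
    ring

/-- The Pfaffian of the contraction of the top form with a word of linear forms. For a word of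
coordinate functions this is the signed Pfaffian of the complementary word. -/
noncomputable def coPf (s : List (Fin m → R)) : R :=
  pfFun T hskew hdiag (s.foldr (fun f x => contractVec f x) (wordForm R (List.finRange m)))

lemma ι_mul_contractVec (q : Fin m) (x : ExteriorAlgebra R (Fin m → R)) (f : Fin m → R) :
    ExteriorAlgebra.ι R (Pi.single q 1) * contractVec f x = f q • x -
      contractVec f (ExteriorAlgebra.ι R (Pi.single q 1) * x) := by
  rw [contractVec_ι_mul]
  simp

lemma ι_mul_wordForm_finRange (q : Fin m) :
    ExteriorAlgebra.ι R (Pi.single q 1) * wordForm R (List.finRange m) = 0 :=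
  ι_mul_wordForm_of_mem _ _ (List.mem_finRange q)

/-- Under the functional, contraction with the row T q is multiplication by e_q. In this and the
next two lemmas e_q is moved inwards past the other contractions, leaving one evaluation at each,
until it annihilates the top form. -/
lemma coPf_row_one (q : Fin m) : coPf T hskew hdiag [T q] = 0 := by
  simp only [coPf, List.foldr]
  rw [← pfFun_single_mul, ι_mul_wordForm_finRange, map_zero]

lemma coPf_row_three (q : Fin m) (a b : Fin m → R) : coPf T hskew hdiag [T q, a, b] =
    a q * coPf T hskew hdiag [b] - b q * coPf T hskew hdiag [a] := by
  simp only [coPf, List.foldr]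
  rw [← pfFun_single_mul]
  simp only [ι_mul_contractVec, ι_mul_wordForm_finRange, map_zero, map_sub, map_smul, sub_zero,
    smul_eq_mul]

lemma coPf_row_five (q : Fin m) (a b c d : Fin m → R) : coPf T hskew hdiag [T q, a, b, c, d] =
    a q * coPf T hskew hdiag [b, c, d] - b q * coPf T hskew hdiag [a, c, d]
      + c q * coPf T hskew hdiag [a, b, d] - d q * coPf T hskew hdiag [a, b, c] := by
  simp only [coPf, List.foldr]
  rw [← pfFun_single_mul]
  simp only [ι_mul_contractVec, ι_mul_wordForm_finRange, map_zero, map_sub, map_smul, sub_zero,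
    smul_eq_mul]
  ring

lemma foldr_contractVec_neg (l : List (Fin m → R)) (x : ExteriorAlgebra R (Fin m → R)) :
    l.foldr (fun f x => contractVec f x) (-x) = -l.foldr (fun f x => contractVec f x) x := by
  induction l with
  | nil => rfl
  | cons a l ih => rw [List.foldr_cons, ih, map_neg, List.foldr_cons]

lemma foldr_contractVec_sum_smul {ι : Type*} (s : Finset ι) (a : ι → R)
    (l : List (Fin m → R)) (x : ι → ExteriorAlgebra R (Fin m → R)) :
    l.foldr (fun f x => contractVec f x) (∑ i ∈ s, a i • x i) =
      ∑ i ∈ s, a i • l.foldr (fun f x => contractVec f x) (x i) := by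
  induction l with
  | nil => rfl
  | cons b l ih => simp only [List.foldr_cons, ih, map_sum, map_smul]

lemma contractVec_foldr_of_mem (a : Fin m → R) (l : List (Fin m → R)) (h : a ∈ l)
    (x : ExteriorAlgebra R (Fin m → R)) :
    contractVec a (l.foldr (fun f x => contractVec f x) x) = 0 := by
  induction l with
  | nil => simp at h
  | cons b l ih =>
    rw [List.foldr_cons]
    rcases List.mem_cons.1 h with rfl | h
    · exact contractVec_contractVec _ _
    · rw [contractVec_comm, ih h, map_zero, neg_zero]

lemma coPf_swap (l₁ l₂ : List (Fin m → R)) (a b : Fin m → R) :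
    coPf T hskew hdiag (l₁ ++ a :: b :: l₂) = -coPf T hskew hdiag (l₁ ++ b :: a :: l₂) := by
  rw [coPf, coPf, List.foldr_append, List.foldr_append, ← map_neg, ← foldr_contractVec_neg]
  simp only [List.foldr_cons]
  rw [contractVec_comm]

lemma coPf_sum_smul {ι : Type*} (s : Finset ι) (x : ι → R) (f : ι → Fin m → R)
    (l₁ l₂ : List (Fin m → R)) :
    coPf T hskew hdiag (l₁ ++ (∑ i ∈ s, x i • f i) :: l₂) =
      ∑ i ∈ s, x i * coPf T hskew hdiag (l₁ ++ f i :: l₂) := by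
  simp only [coPf, List.foldr_append, List.foldr_cons, contractVec_sum_smul,
    foldr_contractVec_sum_smul, map_sum, map_smul, smul_eq_mul]

lemma coPf_of_not_nodup (l : List (Fin m → R)) (h : ¬ l.Nodup) : coPf T hskew hdiag l = 0 := by
  have key : l.foldr (fun f x => contractVec f x) (wordForm R (List.finRange m)) = 0 := by
    induction l with
    | nil => simp at h
    | cons a l ih =>
      rw [List.foldr_cons]
      by_cases ha : a ∈ l
      · exact contractVec_foldr_of_mem a l ha _
      · rw [ih (fun hl => h (List.nodup_cons.2 ⟨ha, hl⟩)), map_zero]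
  rw [coPf, key, map_zero]

lemma coPf_map_single_of_not_nodup (l : List (Fin m)) (h : ¬ l.Nodup) :
    coPf T hskew hdiag (l.map fun i => Pi.single i 1) = 0 := by
  rcases subsingleton_or_nontrivial R with hR | hR
  · exact Subsingleton.elim _ _
  · apply coPf_of_not_nodup
    rwa [List.nodup_map_iff]
    intro i j hij
    by_contra hne
    have : (Pi.single i 1 : Fin m → R) i = (Pi.single j 1 : Fin m → R) i := congrFun hij i
    rw [Pi.single_eq_same, Pi.single_eq_of_ne hne] at this
    exact one_ne_zero this

lemma mem_del {s : List (Fin m)} {x : Fin m} : x ∈ del s ↔ x ∉ s := by simp [del]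

lemma nodup_del (s : List (Fin m)) : (del s).Nodup := (List.nodup_finRange m).filter _

lemma contract_wordForm_finRange (i : Fin m) :
    contract R i (wordForm R (List.finRange m)) = (-1 : R) ^ (i : ℕ) • wordForm R (del [i]) := by
  rw [contract_wordForm i _ (List.nodup_finRange m) (List.mem_finRange i),
    (List.nodup_finRange m).erase_eq_filter]
  congr 2
  · simp
  · unfold del
    congr 1
    funext x
    by_cases h : x = i <;> simp [h]

/-- Rearrange the word so that a and b come first, then contract them away. The list s' is only
required to have the right letters, since `del` does not see their order. -/
lemma contract_contract_wordForm_del (s : List (Fin m)) (a b : Fin m) (h : (s ++ [a, b]).Nodup)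
    (s' : List (Fin m)) (hs' : ∀ x, x ∈ s' ↔ x ∈ s ∨ x = a ∨ x = b) :
    contract R b (contract R a (wordForm R (del s))) =
      ((wordSign (del s) (a :: b :: del s') : ℤ) : R) • wordForm R (del s') := by
  have hab : a ≠ b ∧ a ∉ s ∧ b ∉ s := by
    simp only [List.nodup_append, List.mem_cons, List.nodup_cons] at h
    refine ⟨?_, ?_, ?_⟩
    · rintro rfl; simp at h
    · intro ha; exact h.2.2 a ha a (by simp) rfl
    · intro ha; exact h.2.2 b ha b (by simp) rfl
  have hn : (a :: b :: del s').Nodup := by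
    simp [mem_del, hs', nodup_del, hab.1]
  have hp : (a :: b :: del s').Perm (del s) := by
    rw [List.perm_ext_iff_of_nodup hn (nodup_del s)]
    intro x
    simp only [List.mem_cons, mem_del, hs']
    by_cases h1 : x = a
    · subst h1; simp [hab]
    by_cases h2 : x = b
    · subst h2; simp [hab]
    simp [h1, h2]
  rw [wordForm_eq_wordSign_smul _ _ (nodup_del s) hp, map_smul, map_smul,
    contract_wordForm_cons_self _ _ (List.nodup_cons.1 hn).1,
    contract_wordForm_cons_self _ _ (List.nodup_cons.1 (List.nodup_cons.1 hn).2).1]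

lemma gen_eq_coPf (i : Fin m) : gen T i = coPf T hskew hdiag [Pi.single i 1] := by
  rw [coPf, List.foldr_cons, List.foldr_nil, contractVec_single,
    contract_wordForm_finRange, map_smul,
    ← pf_eq_pfFun T hskew hdiag _ _ rfl (nodup_del _), gen, pfDel, if_pos (by simp), smul_eq_mul]

/-- The fold contracts with the last vector first, so the list is reversed: i is removed first and
gives (-1)^i, then j and r give the sign of the rearranged word. -/
lemma sig3_mul_eq_coPf (i j r : Fin m) :
    (sig3 i j r : R) * pfDel T [i, j, r] =
      coPf T hskew hdiag [Pi.single r 1, Pi.single j 1, Pi.single i 1] := by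
  by_cases h : [i, j, r].Nodup
  · rw [coPf]
    simp only [List.foldr_cons, List.foldr_nil, contractVec_single]
    rw [contract_wordForm_finRange, map_smul, map_smul,
      contract_contract_wordForm_del [i] j r h [i, j, r] (by simp), map_smul, map_smul,
      ← pf_eq_pfFun T hskew hdiag _ _ rfl (nodup_del _), sig3, pfDel, if_pos h, if_pos h]
    simp only [smul_eq_mul]
    push_cast
    ring
  · rw [sig3, if_neg h, Int.cast_zero, zero_mul]
    refine (coPf_map_single_of_not_nodup T hskew hdiag [r, j, i] ?_).symm
    rwa [← List.nodup_reverse] at h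

lemma sig5_mul_eq_coPf (i j r h k : Fin m) :
    (sig3 i j r : R) * ((sig5 i j r h k : R) * pfDel T [i, j, r, h, k]) =
      coPf T hskew hdiag
        [Pi.single h 1, Pi.single k 1, Pi.single r 1, Pi.single j 1, Pi.single i 1] := by
  by_cases hn : [i, j, r, h, k].Nodup
  · have h3 : [i, j, r].Nodup := hn.sublist (by simp)
    have h5 : ([i, j, r] ++ [k, h]).Nodup := by
      refine (List.Perm.nodup_iff ?_).1 hn
      exact List.Perm.append_left [i, j, r] (List.Perm.swap k h [])
    -- The sign lists k before h and the pfaffian h before k; the remaining word is the same.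
    have hdel : del [i, j, r, k, h] = del [i, j, r, h, k] := by
      unfold del
      apply List.filter_congr
      intro x _
      simp only [List.mem_cons, List.not_mem_nil, or_false, decide_eq_decide]
      tauto
    rw [coPf]
    simp only [List.foldr_cons, List.foldr_nil, contractVec_single]
    rw [contract_wordForm_finRange]
    simp only [map_smul]
    rw [contract_contract_wordForm_del [i] j r h3 [i, j, r] (by simp)]
    simp only [map_smul]
    rw [contract_contract_wordForm_del [i, j, r] k h h5 [i, j, r, k, h] (by simp; tauto)]
    simp only [map_smul]
    rw [hdel, ← pf_eq_pfFun T hskew hdiag _ _ rfl (nodup_del _), sig3, sig5, pfDel, if_pos h3,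
      if_pos hn, if_pos hn, hdel]
    simp only [smul_eq_mul]
    push_cast
    ring
  · rw [sig5, if_neg hn, Int.cast_zero, zero_mul, mul_zero]
    refine (coPf_map_single_of_not_nodup T hskew hdiag [h, k, r, j, i] ?_).symm
    intro h'
    apply hn
    refine (List.Perm.nodup_iff ?_).1 h'
    rw [← List.reverse_perm']
    exact List.Perm.append_left [i, j, r] (List.Perm.swap h k [])

end

/-! ### The constants of the complex as values of `coPf`, and their relations -/

section Constants

variable {R : Type*} [CommRing R] {m : ℕ}
variable (T : Matrix (Fin m) (Fin m) R) (hskew : ∀ i j, T j i = -T i j) (hdiag : ∀ i, T i i = 0)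

lemma coPf_eq_sum (f : Fin m → R) (l₁ l₂ : List (Fin m → R)) :
    coPf T hskew hdiag (l₁ ++ f :: l₂) =
      ∑ i, f i * coPf T hskew hdiag (l₁ ++ Pi.single i 1 :: l₂) := by
  conv_lhs => rw [← sum_smul_single_one f]
  rw [coPf_sum_smul]

lemma coPf_three_swap_left (a b c : Fin m → R) :
    coPf T hskew hdiag [a, b, c] = -coPf T hskew hdiag [b, a, c] := coPf_swap T hskew hdiag [] _ _ _

lemma coPf_three_swap_right (a b c : Fin m → R) :
    coPf T hskew hdiag [a, b, c] = -coPf T hskew hdiag [a, c, b] :=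
  coPf_swap T hskew hdiag [a] _ _ _

lemma coPf_five_swap_zero (a b c d e : Fin m → R) :
    coPf T hskew hdiag [a, b, c, d, e] = -coPf T hskew hdiag [b, a, c, d, e] :=
  coPf_swap T hskew hdiag [] _ _ _

lemma coPf_five_swap_one (a b c d e : Fin m → R) :
    coPf T hskew hdiag [a, b, c, d, e] = -coPf T hskew hdiag [a, c, b, d, e] :=
  coPf_swap T hskew hdiag [a] _ _ _

lemma coPf_five_swap_two (a b c d e : Fin m → R) :
    coPf T hskew hdiag [a, b, c, d, e] = -coPf T hskew hdiag [a, b, d, c, e] :=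
  coPf_swap T hskew hdiag [a, b] _ _ _

lemma coPf_five_swap_three (a b c d e : Fin m → R) :
    coPf T hskew hdiag [a, b, c, d, e] = -coPf T hskew hdiag [a, b, c, e, d] :=
  coPf_swap T hskew hdiag [a, b, c] _ _ _

/-- The coefficient of `f r` in the product of `e i` and `e j`. -/
def triple (i j r : Fin m) : R := (sig3 i j r : R) * pfDel T [i, j, r]

lemma triple_eq_coPf (i j r : Fin m) : triple T i j r =
    coPf T hskew hdiag [Pi.single r 1, Pi.single j 1, Pi.single i 1] :=
  sig3_mul_eq_coPf T hskew hdiag i j r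

lemma sum_triple_mul (i j : Fin m) (f : Fin m → R) : ∑ r, triple T i j r * f r =
    coPf T hskew hdiag [f, Pi.single j 1, Pi.single i 1] := by
  rw [show coPf T hskew hdiag [f, Pi.single j 1, Pi.single i 1] = _ from
    coPf_eq_sum T hskew hdiag f [] [Pi.single j 1, Pi.single i 1]]
  exact Finset.sum_congr rfl fun r _ => by
    rw [triple_eq_coPf T hskew hdiag, mul_comm]; rfl

include hskew hdiag in
lemma triple_swap (i j r : Fin m) : triple T i j r = -triple T j i r := by
  rw [triple_eq_coPf T hskew hdiag, triple_eq_coPf T hskew hdiag, coPf_three_swap_right]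

include hskew hdiag in
lemma triple_cycle (i j r : Fin m) : triple T i j r = triple T j r i := by
  rw [triple_eq_coPf T hskew hdiag, triple_eq_coPf T hskew hdiag, coPf_three_swap_right,
    coPf_three_swap_left, neg_neg]

include hskew hdiag in
lemma triple_self (i r : Fin m) : triple T i i r = 0 := by
  rw [triple_eq_coPf T hskew hdiag, coPf_of_not_nodup]
  simp

include hskew hdiag in
-- In the pfaffian resolution this says ∂(e_i e_j) = y_i e_j - y_j e_i.
lemma sum_triple_mul_row (i j s : Fin m) : ∑ r, triple T i j r * T s r =
    (if s = j then gen T i else 0) - if s = i then gen T j else 0 := by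
  rw [sum_triple_mul T hskew hdiag, coPf_row_three, gen_eq_coPf T hskew hdiag,
    gen_eq_coPf T hskew hdiag]
  simp [Pi.single_apply]

include hskew hdiag in
lemma sum_row_mul_gen (s : Fin m) : ∑ i, T s i * gen T i = 0 := by
  rw [← coPf_row_one T hskew hdiag s, show coPf T hskew hdiag [T s] = _ from
    coPf_eq_sum T hskew hdiag (T s) [] []]
  exact Finset.sum_congr rfl fun r _ => by rw [gen_eq_coPf T hskew hdiag]; rfl

variable (c : Fin m → Fin m → Fin 3 → R) (z : Fin 3 → R)

/-- The vector of the coefficients `c r k l`. -/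
def col (k : Fin m) (l : Fin 3) : Fin m → R := fun r => c r k l

/-- In this form the symmetries of d^{k,i,j}, and its vanishing on repeated indices, are those of an
alternating function. -/
lemma dThree_eq_coPf (k i j : Fin m) (α β : Fin 3) : dThree T c k i j α β =
    coPf T hskew hdiag [col c k α, Pi.single k 1, col c k β, Pi.single j 1, Pi.single i 1] := by
  rw [show coPf T hskew hdiag [col c k α, Pi.single k 1, col c k β, Pi.single j 1, Pi.single i 1]
    = _ from coPf_eq_sum T hskew hdiag (col c k β) [col c k α, Pi.single k 1] _, dThree]
  refine Finset.sum_congr rfl fun r _ => ?_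
  rw [show coPf T hskew hdiag ([col c k α, Pi.single k 1] ++ Pi.single r 1 ::
    [Pi.single j 1, Pi.single i 1]) = _ from coPf_eq_sum T hskew hdiag (col c k α) [] _,
    Finset.mul_sum, Finset.mul_sum]
  refine Finset.sum_congr rfl fun h _ => ?_
  have := sig5_mul_eq_coPf T hskew hdiag i j r h k
  change _ = c r k β * (c h k α * coPf T hskew hdiag
    [Pi.single h 1, Pi.single k 1, Pi.single r 1, Pi.single j 1, Pi.single i 1])
  rw [← this]
  ring

lemma dOne_eq_coPf (k : Fin m) (α β : Fin 3) : dOne T c k α β =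
    coPf T hskew hdiag [col c k α, Pi.single k 1, col c k β] := by
  rw [show coPf T hskew hdiag [col c k α, Pi.single k 1, col c k β]
    = _ from coPf_eq_sum T hskew hdiag (col c k β) [col c k α, Pi.single k 1] _, dOne]
  refine Finset.sum_congr rfl fun r _ => ?_
  rw [show coPf T hskew hdiag ([col c k α, Pi.single k 1] ++ [Pi.single r 1])
    = _ from coPf_eq_sum T hskew hdiag (col c k α) [] _, Finset.mul_sum]
  refine Finset.sum_congr rfl fun h _ => ?_
  have := sig3_mul_eq_coPf T hskew hdiag r k h
  change _ = c r k β * (c h k α * coPf T hskew hdiag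
    [Pi.single h 1, Pi.single k 1, Pi.single r 1])
  rw [← this]
  ring

lemma dFour_self (i j : Fin m) (l α β : Fin 3) : dFour T c z i i j l α β =
    if l = α then coPf T hskew hdiag [col c i β, Pi.single j 1, Pi.single i 1]
    else if l = β then -coPf T hskew hdiag [col c i α, Pi.single j 1, Pi.single i 1] else 0 := by
  rw [dFour, if_neg (by simp), ← sum_triple_mul, ← sum_triple_mul]
  rfl

lemma dFour_of_ne {k i : Fin m} (h : k ≠ i) (j : Fin m) (l α β : Fin 3) :
    dFour T c z k i j l α β = z l * dThree T c k i j α β := by rw [dFour, if_pos h]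

include hskew hdiag in
lemma dThree_swap (k i j : Fin m) (α β : Fin 3) :
    dThree T c k i j α β = -dThree T c k j i α β := by
  rw [dThree_eq_coPf T hskew hdiag, dThree_eq_coPf T hskew hdiag, coPf_five_swap_three]

include hskew hdiag in
lemma dThree_self (k i : Fin m) (α β : Fin 3) : dThree T c k i i α β = 0 := by
  rw [dThree_eq_coPf T hskew hdiag, coPf_of_not_nodup]
  simp

include hskew hdiag in
lemma dThree_right (k i : Fin m) (α β : Fin 3) : dThree T c k i k α β = 0 := by
  rw [dThree_eq_coPf T hskew hdiag, coPf_of_not_nodup]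
  simp

include hskew hdiag in
lemma dThree_swap_pair (k i j : Fin m) (α β : Fin 3) :
    dThree T c k i j β α = -dThree T c k i j α β := by
  rw [dThree_eq_coPf T hskew hdiag, dThree_eq_coPf T hskew hdiag, coPf_five_swap_zero,
    coPf_five_swap_one, coPf_five_swap_zero]
  simp

include hskew hdiag in
lemma dThree_pair_self (k i j : Fin m) (α : Fin 3) : dThree T c k i j α α = 0 := by
  rw [dThree_eq_coPf T hskew hdiag, coPf_of_not_nodup]
  simp

include hskew hdiag in
lemma dOne_swap_pair (k : Fin m) (α β : Fin 3) : dOne T c k β α = -dOne T c k α β := by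
  rw [dOne_eq_coPf T hskew hdiag, dOne_eq_coPf T hskew hdiag, coPf_three_swap_left,
    coPf_three_swap_right, coPf_three_swap_left]
  simp

include hskew hdiag in
lemma dOne_pair_self (k : Fin m) (α : Fin 3) : dOne T c k α α = 0 := by
  rw [dOne_eq_coPf T hskew hdiag, coPf_of_not_nodup]
  simp

variable (hc : ∀ i j, T j i = ∑ l, c i j l * z l)

include hc in
lemma row_eq_sum_col (k : Fin m) : T k = ∑ l, z l • col c k l := by
  funext h
  simp [hc h k, col, mul_comm]

include hc in
lemma sum_mul_coPf_col (k : Fin m) (s : List (Fin m → R)) :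
    ∑ l, z l * coPf T hskew hdiag (col c k l :: s) = coPf T hskew hdiag (T k :: s) := by
  rw [row_eq_sum_col T c z hc k]
  exact (coPf_sum_smul T hskew hdiag _ _ _ [] _).symm

include hskew hdiag hc in
-- Summing against z puts the row T k in first place. Of its expansion only the e_k term survives: i
-- and j differ from k, and c k k l = 0. Thus the v-part of e_i e_j cancels the u-coordinates of the
-- boundary of its f-part.
lemma sum_mul_dThree {k i j : Fin m} (hk : ∀ l, c k k l = 0) (hi : k ≠ i) (hj : k ≠ j) (l : Fin 3) :
    ∑ α, z α * dThree T c k i j α l = ∑ r, triple T i j r * c r k l := by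
  simp only [dThree_eq_coPf T hskew hdiag]
  rw [sum_mul_coPf_col T hskew hdiag c z hc, coPf_row_five]
  simp only [Pi.single_eq_same, Pi.single_eq_of_ne hi, Pi.single_eq_of_ne hj]
  rw [show col c k l k = 0 from hk l]
  have := sum_triple_mul T hskew hdiag i j (col c k l)
  simp only [col] at this ⊢
  rw [this]
  ring

include hskew hdiag hc in
-- The same argument with three vectors; it is what makes ∂∂g vanish.
lemma sum_mul_dOne {k : Fin m} (hk : ∀ l, c k k l = 0) (l : Fin 3) :
    ∑ α, z α * dOne T c k α l = ∑ i, gen T i * c i k l := by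
  simp only [dOne_eq_coPf T hskew hdiag]
  rw [sum_mul_coPf_col T hskew hdiag c z hc, coPf_row_three, show col c k l k = 0 from hk l,
    show coPf T hskew hdiag [col c k l] = _ from coPf_eq_sum T hskew hdiag _ [] []]
  simp only [Pi.single_eq_same, one_mul, zero_mul, sub_zero]
  refine Finset.sum_congr rfl fun i _ => ?_
  rw [gen_eq_coPf T hskew hdiag, mul_comm]
  rfl

include hskew hdiag hc in
lemma sum_mul_coPf_col_self {i j : Fin m} (hij : i ≠ j) :
    ∑ α, z α * coPf T hskew hdiag [col c i α, Pi.single j 1, Pi.single i 1] = -gen T j := by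
  rw [sum_mul_coPf_col T hskew hdiag c z hc, coPf_row_three, gen_eq_coPf T hskew hdiag]
  simp [Pi.single_eq_of_ne hij]

include hskew hdiag hc in
/-- The relation behind the products of the `e i` and the `f j` modulo the Koszul part. -/
lemma sum_mul_dThree_add {k i j : Fin m} (hk : ∀ l, c k k l = 0) (hki : k ≠ i) (α β : Fin 3) :
    (∑ s, T j s * dThree T c k i s α β)
      + c j k α * coPf T hskew hdiag [col c k β, Pi.single i 1, Pi.single k 1]
      - c j k β * coPf T hskew hdiag [col c k α, Pi.single i 1, Pi.single k 1] =
    (if i = j then dOne T c k α β else 0) +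
      if j = k then ∑ γ, z γ * coPf T hskew hdiag
        [col c k γ, Pi.single k 1, col c k α, col c k β, Pi.single i 1] else 0 := by
  -- Three transpositions move the row T j from fourth to first place, hence the minus sign. The sum
  -- over γ on the right likewise has T k in first place, and both are then expanded.
  have h1 : ∑ s, T j s * dThree T c k i s α β = -coPf T hskew hdiag
      [T j, col c k α, Pi.single k 1, col c k β, Pi.single i 1] := by
    rw [coPf_five_swap_zero, coPf_five_swap_one, coPf_five_swap_two, neg_neg, neg_neg,
      show coPf T hskew hdiag [col c k α, Pi.single k 1, col c k β, T j, Pi.single i 1] = _ from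
        coPf_eq_sum T hskew hdiag (T j) [col c k α, Pi.single k 1, col c k β] _]
    refine Finset.sum_congr rfl fun s _ => ?_
    rw [dThree_eq_coPf T hskew hdiag]
    rfl
  rw [h1, coPf_row_five, sum_mul_coPf_col T hskew hdiag c z hc, coPf_row_five, dOne_eq_coPf T hskew
    hdiag, show col c k α k = 0 from hk α, show col c k β k = 0 from hk β,
    show col c k α j = c j k α from rfl, show col c k β j = c j k β from rfl]
  have h2 : coPf T hskew hdiag [Pi.single k 1, col c k β, Pi.single i 1] =
      coPf T hskew hdiag [col c k β, Pi.single i 1, Pi.single k 1] := by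
    rw [coPf_three_swap_left, coPf_three_swap_right, neg_neg]
  have h3 : coPf T hskew hdiag [col c k α, Pi.single k 1, Pi.single i 1] =
      -coPf T hskew hdiag [col c k α, Pi.single i 1, Pi.single k 1] := coPf_three_swap_right ..
  rw [h2, h3]
  by_cases hij : i = j
  · subst hij
    simp [hki.symm]
    ring
  · by_cases hjk : j = k
    · subst hjk
      simp [hij]
      ring
    · simp [hij, hjk]

include hskew hdiag in
lemma sum_col_mul_dThree (k i : Fin m) (γ α β : Fin 3) :
    ∑ r, c r k γ * dThree T c k i r α β =
      coPf T hskew hdiag [col c k α, Pi.single k 1, col c k β, col c k γ, Pi.single i 1] := by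
  rw [show coPf T hskew hdiag [col c k α, Pi.single k 1, col c k β, col c k γ, Pi.single i 1] = _
    from coPf_eq_sum T hskew hdiag (col c k γ) [col c k α, Pi.single k 1, col c k β] _]
  refine Finset.sum_congr rfl fun s _ => ?_
  rw [dThree_eq_coPf T hskew hdiag]
  rfl

end Constants

/-! ### Exactness from null-homotopies and a regular triple -/

section Exactness

variable {R : Type*} [CommRing R]

/-- Three elements of `I` that form a weakly regular sequence on the ring. -/
def HasRegularTriple (I : Ideal R) : Prop :=
  ∃ a₁ ∈ I, ∃ a₂ ∈ I, ∃ a₃ ∈ I, (∀ x, a₁ * x = 0 → x = 0) ∧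
    (∀ x, a₂ * x ∈ Ideal.span {a₁} → x ∈ Ideal.span {a₁}) ∧
    ∀ x, a₃ * x ∈ Ideal.span {a₁} ⊔ Ideal.span {a₂} → x ∈ Ideal.span {a₁} ⊔ Ideal.span {a₂}

lemma HasRegularTriple.mono {I J : Ideal R} (h : HasRegularTriple I) (hIJ : I ≤ J) :
    HasRegularTriple J := by
  obtain ⟨a₁, h₁, a₂, h₂, a₃, h₃, h⟩ := h
  exact ⟨a₁, hIJ h₁, a₂, hIJ h₂, a₃, hIJ h₃, h⟩

lemma hasRegularTriple_of_idealGrade {I : Ideal R} (h : 3 ≤ idealGrade I) :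
    HasRegularTriple I := by
  have h2 : (2 : ℕ∞) < idealGrade I := lt_of_lt_of_le (by norm_num) h
  obtain ⟨⟨rs, hrs, hI⟩, hlen⟩ := lt_iSup_iff.1 h2
  have hlen' : 2 < rs.length := by exact_mod_cast hlen
  match rs, hrs, hI, hlen' with
  | a₁ :: a₂ :: a₃ :: rs, hrs, hI, hlen' =>
    refine ⟨a₁, hI _ (by simp), a₂, hI _ (by simp), a₃, hI _ (by simp), ?_, ?_, ?_⟩
    · intro x hx
      have := (isSMulRegular_quotient_iff_mem_of_smul_mem _ _).1
        (hrs.regular_mod_prev 0 (by simp)) x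
      simpa using this (by simpa using hx)
    · intro x hx
      have := (isSMulRegular_quotient_iff_mem_of_smul_mem _ _).1
        (hrs.regular_mod_prev 1 (by simp)) x
      simpa using this (by simpa using hx)
    · intro x hx
      have := (isSMulRegular_quotient_iff_mem_of_smul_mem _ _).1
        (hrs.regular_mod_prev 2 (by simp)) x
      simpa using this (by simpa using hx)

/-- The sequence 1, 1, 1, 1 is weakly regular. This excludes m = 1, where the only generator is the
empty pfaffian 1. -/
lemma idealGrade_top : idealGrade (⊤ : Ideal R) ≠ 3 := by
  intro h
  have hreg : RingTheory.Sequence.IsWeaklyRegular R ([1, 1, 1, 1] : List R) := by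
    refine ⟨fun i hi => ?_⟩
    have : ([1, 1, 1, 1] : List R)[i] = 1 := by
      simp only [List.length_cons, List.length_nil] at hi
      interval_cases i <;> rfl
    rw [this]
    exact IsSMulRegular.one _
  have h4 : ((4 : ℕ) : ℕ∞) ≤ idealGrade (⊤ : Ideal R) :=
    le_iSup_of_le (f := fun rs : {rs : List R // RingTheory.Sequence.IsWeaklyRegular R rs ∧
      ∀ r ∈ rs, r ∈ (⊤ : Ideal R)} => (rs.1.length : ℕ∞)) ⟨[1, 1, 1, 1], hreg, by simp⟩ (by simp)
  rw [h] at h4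
  exact absurd h4 (by norm_num)

variable {ι : Type*} [Fintype ι]

/-- Write a = ∑ α_i y_i and s = ∑ α_i f_i, so a f ≡ s y modulo K. Then s y lies in K + (a), hence so
does b s, hence so does s. With s ≡ t a modulo K, cancelling a gives f ≡ t y. -/
lemma exists_smul_of_commute_mod (y f : ι → R) (K : Ideal R) {a b : R}
    (ha : a ∈ Ideal.span (Set.range y)) (hb : b ∈ Ideal.span (Set.range y))
    (hra : ∀ x, a * x ∈ K → x ∈ K)
    (hrb : ∀ x, b * x ∈ K ⊔ Ideal.span {a} → x ∈ K ⊔ Ideal.span {a})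
    (hf : ∀ i q, y i * f q - f i * y q ∈ K) : ∃ s, ∀ q, f q - s * y q ∈ K := by
  obtain ⟨α, rfl⟩ := (Ideal.mem_span_range_iff_exists_fun).1 ha
  have h1 : ∀ q, (∑ i, α i * y i) * f q - (∑ i, α i * f i) * y q ∈ K := by
    intro q
    rw [Finset.sum_mul, Finset.sum_mul, ← Finset.sum_sub_distrib]
    refine K.sum_mem fun i _ => ?_
    convert K.mul_mem_left (α i) (hf i q) using 1
    ring
  set a := ∑ i, α i * y i
  set s := ∑ i, α i * f i
  have h2 : ∀ q, s * y q ∈ K ⊔ Ideal.span {a} := by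
    intro q
    have : s * y q = -(a * f q - s * y q) + a * f q := by ring
    rw [this]
    exact Ideal.add_mem _ (Ideal.neg_mem_iff _ |>.2 (Ideal.mem_sup_left (h1 q)))
      (Ideal.mem_sup_right (Ideal.mul_mem_right _ _ (Ideal.mem_span_singleton_self a)))
  have h3 : s ∈ K ⊔ Ideal.span {a} := by
    apply hrb
    obtain ⟨β, rfl⟩ := (Ideal.mem_span_range_iff_exists_fun).1 hb
    rw [Finset.sum_mul]
    refine Ideal.sum_mem _ fun i _ => ?_
    have : β i * y i * s = β i * (s * y i) := by ring
    rw [this]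
    exact Ideal.mul_mem_left _ _ (h2 i)
  obtain ⟨κ, hκ, x, hx, hs⟩ := Submodule.mem_sup.1 h3
  obtain ⟨t, rfl⟩ := Ideal.mem_span_singleton'.1 hx
  refine ⟨t, fun q => hra _ ?_⟩
  have : a * (f q - t * y q) = (a * f q - s * y q) + κ * y q := by rw [← hs]; ring
  rw [this]
  exact K.add_mem (h1 q) (K.mul_mem_right _ hκ)

variable {y : ι → R} {T : ι → ι → R}

lemma eq_zero_of_mul_eq_zero (hreg : HasRegularTriple (Ideal.span (Set.range y))) {s : R}
    (hs : ∀ q, s * y q = 0) : s = 0 := by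
  obtain ⟨a₁, h₁, -, -, -, -, hr₁, -, -⟩ := hreg
  apply hr₁
  obtain ⟨α, rfl⟩ := (Ideal.mem_span_range_iff_exists_fun).1 h₁
  rw [Finset.sum_mul]
  exact Finset.sum_eq_zero fun i _ => by rw [mul_assoc, mul_comm (y i), hs, mul_zero]

lemma exists_smul_of_mulVec_eq_zero (hreg : HasRegularTriple (Ideal.span (Set.range y)))
    (h₂ : ∀ (K : Ideal R) (f : ι → R), (∀ q, ∑ r, T q r * f r ∈ K) →
      ∀ i q, y i * f q - f i * y q ∈ K)
    (f : ι → R) (hf : ∀ q, ∑ r, T q r * f r = 0) : ∃ s, ∀ q, f q = s * y q := by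
  obtain ⟨a₁, h₁, a₂, h₂', a₃, -, hr₁, hr₂, -⟩ := hreg
  obtain ⟨s, hs⟩ := exists_smul_of_commute_mod y f ⊥ h₁ h₂' (by simpa using hr₁)
    (by simpa using hr₂) (h₂ ⊥ f (by simpa using hf))
  exact ⟨s, fun q => sub_eq_zero.1 (by simpa using hs q)⟩

/-- The homotopies `h₁` give a₁ A = T F. Modulo a₁ the vector F is in the kernel of T, so by
`exists_smul_of_commute_mod` with a₂, a₃ it has the form F = a₁ g + s y. Since T y = 0, cancelling
a₁ leaves A = T g. -/
lemma exists_mulVec_eq (hreg : HasRegularTriple (Ideal.span (Set.range y)))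
    (hT : ∀ q, ∑ r, T q r * y r = 0)
    (h₁ : ∀ i (A : ι → R), ∑ j, A j * y j = 0 → ∃ f : ι → R, ∀ q, y i * A q = ∑ r, T q r * f r)
    (h₂ : ∀ (K : Ideal R) (f : ι → R), (∀ q, ∑ r, T q r * f r ∈ K) →
      ∀ i q, y i * f q - f i * y q ∈ K)
    (A : ι → R) (hA : ∑ j, A j * y j = 0) : ∃ f : ι → R, ∀ q, A q = ∑ r, T q r * f r := by
  obtain ⟨a₁, ha₁, a₂, ha₂, a₃, ha₃, hr₁, hr₂, hr₃⟩ := hreg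
  obtain ⟨α, hα⟩ := (Ideal.mem_span_range_iff_exists_fun).1 ha₁
  choose F hF using fun i => h₁ i A hA
  have hf : ∀ q, a₁ * A q = ∑ r, T q r * ∑ i, α i * F i r := by
    intro q
    rw [← hα, Finset.sum_mul]
    simp only [Finset.mul_sum]
    rw [Finset.sum_comm]
    refine Finset.sum_congr rfl fun i _ => ?_
    rw [mul_assoc, hF, Finset.mul_sum]
    exact Finset.sum_congr rfl fun r _ => by ring
  obtain ⟨s, hs⟩ := exists_smul_of_commute_mod y (fun r => ∑ i, α i * F i r) (Ideal.span {a₁})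
    ha₂ ha₃ hr₂ hr₃ (h₂ _ _ fun q => by
      rw [← hf]
      exact Ideal.mul_mem_right _ _ (Ideal.mem_span_singleton_self a₁))
  choose g hg using fun q => Ideal.mem_span_singleton'.1 (hs q)
  refine ⟨g, fun q => sub_eq_zero.1 (hr₁ _ ?_)⟩
  have h3 : ∀ r, ∑ i, α i * F i r = a₁ * g r + s * y r := fun r => by
    rw [mul_comm a₁, hg]; ring
  rw [mul_sub, hf]
  simp only [h3, mul_add, Finset.sum_add_distrib]
  have h4 : ∑ r, T q r * (s * y r) = 0 := by
    rw [← mul_zero s, ← hT q, Finset.mul_sum]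
    exact Finset.sum_congr rfl fun r _ => by ring
  rw [h4, add_zero, Finset.mul_sum, sub_eq_zero]
  exact Finset.sum_congr rfl fun r _ => by ring

end Exactness

/-! ### The Koszul complex on three elements -/

section Koszul

variable {R : Type*} [CommRing R] {z : Fin 3 → R}

/-- The matrix is skew-symmetric with signed submaximal pfaffians z, so the Koszul complex is the
pfaffian complex with m = 3. An ideal K is carried along because exactness in the middle is argued
modulo a regular element. -/
lemma koszul_commute (z : Fin 3 → R) (K : Ideal R) (f : Fin 3 → R)
    (hf : ∀ q, ∑ r, (![![0, z 2, -z 1], ![-z 2, 0, z 0], ![z 1, -z 0, 0]] : Fin 3 → Fin 3 → R) q r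
      * f r ∈ K) (i q : Fin 3) : z i * f q - f i * z q ∈ K := by
  have h0 := hf 0
  have h1 := hf 1
  have h2 := hf 2
  simp [Fin.sum_univ_three] at h0 h1 h2
  have h0' := K.neg_mem h0
  have h1' := K.neg_mem h1
  have h2' := K.neg_mem h2
  fin_cases i <;> fin_cases q <;> simp only [Fin.zero_eta, Fin.mk_one, Fin.reduceFinMk]
  · convert K.zero_mem using 1; ring
  · convert h2' using 1; ring
  · convert h1 using 1; ring
  · convert h2 using 1; ring
  · convert K.zero_mem using 1; ring
  · convert h0' using 1; ring
  · convert h1' using 1; ring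
  · convert h0 using 1; ring
  · convert K.zero_mem using 1; ring

lemma koszul_exact_one (hreg : HasRegularTriple (Ideal.span (Set.range z))) (b : Fin 3 → R)
    (hb : ∑ l, z l * b l = 0) : ∃ p q r : R, b 0 = -(z 1 * p) - z 2 * q ∧
      b 1 = z 0 * p - z 2 * r ∧ b 2 = z 0 * q + z 1 * r := by
  have hT : ∀ q, ∑ r, (![![0, z 2, -z 1], ![-z 2, 0, z 0], ![z 1, -z 0, 0]] :
      Fin 3 → Fin 3 → R) q r * z r = 0 := by
    intro q
    fin_cases q <;> simp [Fin.sum_univ_three] <;> ring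
  have h₁ : ∀ i (A : Fin 3 → R), ∑ j, A j * z j = 0 → ∃ f : Fin 3 → R, ∀ q, z i * A q =
      ∑ r, (![![0, z 2, -z 1], ![-z 2, 0, z 0], ![z 1, -z 0, 0]] : Fin 3 → Fin 3 → R) q r
        * f r := by
    intro i A hA
    rw [Fin.sum_univ_three] at hA
    fin_cases i
    · refine ⟨![0, -A 2, A 1], fun q => ?_⟩
      fin_cases q <;> simp [Fin.sum_univ_three]
      linear_combination hA
    · refine ⟨![A 2, 0, -A 0], fun q => ?_⟩
      fin_cases q <;> simp [Fin.sum_univ_three]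
      linear_combination hA
    · refine ⟨![-A 1, A 0, 0], fun q => ?_⟩
      fin_cases q <;> simp [Fin.sum_univ_three]
      linear_combination hA
  obtain ⟨f, hf⟩ := exists_mulVec_eq hreg hT h₁ (koszul_commute z) b
    (by simpa [mul_comm] using hb)
  refine ⟨f 2, -f 1, f 0, ?_, ?_, ?_⟩
  · rw [hf]; simp [Fin.sum_univ_three]; ring
  · rw [hf]; simp [Fin.sum_univ_three]; ring
  · rw [hf]; simp [Fin.sum_univ_three]; ring

lemma koszul_exact_two (hreg : HasRegularTriple (Ideal.span (Set.range z))) {p q r : R}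
    (h0 : -(z 1 * p) - z 2 * q = 0) (h1 : z 0 * p - z 2 * r = 0) (h2 : z 0 * q + z 1 * r = 0) :
    ∃ s, p = s * z 2 ∧ q = -(s * z 1) ∧ r = s * z 0 := by
  obtain ⟨s, hs⟩ := exists_smul_of_mulVec_eq_zero (y := z)
    (T := ![![0, z 2, -z 1], ![-z 2, 0, z 0], ![z 1, -z 0, 0]]) hreg (koszul_commute z)
    ![r, -q, p] (by
      intro i
      fin_cases i <;> simp [Fin.sum_univ_three]
      · linear_combination h0
      · linear_combination h1
      · linear_combination h2)
  exact ⟨s, by simpa using hs 2, by simpa using congrArg Neg.neg (hs 1), by simpa using hs 0⟩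

end Koszul

/-! ### The pfaffian complex and its ideal -/

section PfaffianIdeal

variable {R : Type*} [CommRing R] {m : ℕ}
variable (T : Matrix (Fin m) (Fin m) R) (hskew : ∀ i j, T j i = -T i j) (hdiag : ∀ i, T i i = 0)

include hskew hdiag in
lemma gen_smul_mem_range (i : Fin m) (A : Fin m → R) (hA : ∑ j, A j * gen T j = 0) :
    ∃ f : Fin m → R, ∀ q, gen T i * A q = ∑ r, T q r * f r := by
  -- The product of e_i with the cycle A: its boundary is y_i A, the other term being a multiple of
  -- ∂A = 0.
  refine ⟨fun r => ∑ j, A j * triple T i j r, fun q => ?_⟩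
  have h : ∑ r, T q r * ∑ j, A j * triple T i j r =
      ∑ j, A j * ((if q = j then gen T i else 0) - if q = i then gen T j else 0) := by
    simp only [Finset.mul_sum, ← sum_triple_mul_row T hskew hdiag]
    rw [Finset.sum_comm]
    exact Finset.sum_congr rfl fun j _ => Finset.sum_congr rfl fun r _ => by ring
  rw [h]
  simp only [mul_sub, Finset.sum_sub_distrib, mul_ite, mul_zero, Finset.sum_ite_eq,
    Finset.mem_univ, if_true]
  by_cases hq : q = i <;> simp [hq, hA, mul_comm]

include hskew hdiag in
lemma gen_commute_mod (K : Ideal R) (f : Fin m → R) (hf : ∀ q, ∑ r, T q r * f r ∈ K)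
    (i q : Fin m) : gen T i * f q - f i * gen T q ∈ K := by
  -- The next null-homotopy: both sides agree as linear functions of f, and the right side only
  -- involves T f.
  have h : gen T i * f q - f i * gen T q = ∑ s, triple T q i s * ∑ r, T s r * f r := by
    have h1 : ∑ s, triple T q i s * ∑ r, T s r * f r =
        -∑ r, f r * ((if r = i then gen T q else 0) - if r = q then gen T i else 0) := by
      simp only [Finset.mul_sum, ← sum_triple_mul_row T hskew hdiag, ← Finset.sum_neg_distrib]
      rw [Finset.sum_comm]
      refine Finset.sum_congr rfl fun r _ => Finset.sum_congr rfl fun s _ => ?_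
      rw [hskew r s]
      ring
    rw [h1]
    simp [mul_sub, mul_comm]
  rw [h]
  exact K.sum_mem fun s _ => K.mul_mem_left _ (hf s)

lemma pf_mem_of_ne_nil {I : Ideal R} (hT : ∀ i j, T i j ∈ I) (w : List (Fin m)) (hw : w ≠ []) :
    pf T w ∈ I := by
  obtain ⟨a, l, rfl⟩ := List.exists_cons_of_ne_nil hw
  refine list_sum_mem fun x hx => ?_
  simp only [List.mem_map] at hx
  obtain ⟨j, hj, rfl⟩ := hx
  rw [pairings] at hj
  simp only [List.mem_flatMap, List.mem_map] at hj
  obtain ⟨p, -, q, -, rfl⟩ := hj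
  exact I.mul_mem_left _ (I.mul_mem_right _ (hT _ _))

/-- For m > 1 each submaximal pfaffian is a sum of nonempty products of entries; m = 1 would give
the unit ideal, contrary to grade three. -/
lemma pfIdeal_le {I : Ideal R} (hT : ∀ i j, T i j ∈ I) (hm : Odd m)
    (hgrade : idealGrade (pfIdeal T) = 3) : pfIdeal T ≤ I := by
  obtain hm1 | hm1 := eq_or_ne m 1
  · subst hm1
    exfalso
    apply idealGrade_top (R := R)
    rw [← hgrade]
    congr 1
    symm
    rw [Ideal.eq_top_iff_one]
    apply Ideal.subset_span
    refine ⟨0, ?_⟩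
    have : del [(0 : Fin 1)] = [] := by decide
    simp [gen, pfDel, this, pf, pairings, wordSign, pairProd]
  · rw [pfIdeal, Ideal.span_le]
    rintro _ ⟨i, rfl⟩
    refine I.mul_mem_left _ ?_
    rw [pfDel, if_pos (by simp)]
    refine pf_mem_of_ne_nil T hT _ ?_
    have : 1 < m := by
      obtain ⟨k, rfl⟩ := hm
      omega
    obtain ⟨j, hj⟩ := Fintype.exists_ne_of_one_lt_card (by simpa using this) i
    exact List.ne_nil_of_mem (a := j) (mem_del.2 (by simpa using hj))

end PfaffianIdeal

/-! ### Coordinates of the differential -/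

section Complex

variable {R : Type*} [CommRing R] {m t : ℕ}

instance : Finite (Cell m t) := by
  refine Finite.of_surjective
    (α := (Unit ⊕ High m t ⊕ Low m t × Fin 3) ⊕ (Fin m ⊕ Low m t × Pair) ⊕ Unit ⊕ Low m t)
    (Sum.elim (Sum.elim (fun _ => .one) (Sum.elim .e fun p => .u p.1 p.2))
      (Sum.elim (Sum.elim .f fun p => .v p.1 p.2) (Sum.elim (fun _ => .g) .w))) ?_
  rintro (_ | i | ⟨k, l⟩ | i | ⟨k, p⟩ | _ | k)
  · exact ⟨.inl (.inl ()), rfl⟩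
  · exact ⟨.inl (.inr (.inl i)), rfl⟩
  · exact ⟨.inl (.inr (.inr (k, l))), rfl⟩
  · exact ⟨.inr (.inl (.inl i)), rfl⟩
  · exact ⟨.inr (.inl (.inr (k, p))), rfl⟩
  · exact ⟨.inr (.inr (.inl ())), rfl⟩
  · exact ⟨.inr (.inr (.inr k)), rfl⟩

/-- The element of the complex with given coordinates. -/
noncomputable def ofCoord (f : Cell m t → R) : Res R m t := Finsupp.equivFunOnFinite.symm f

@[simp] lemma ofCoord_apply (f : Cell m t → R) (b : Cell m t) : ofCoord f b = f b := rfl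

/-- The matrix of `v k p ↦ ∂ (v k p)`. -/
def koszulTwo (z : Fin 3 → R) (p : Pair) (l : Fin 3) : R :=
  (if p.1.2 = l then z p.1.1 else 0) - if p.1.1 = l then z p.1.2 else 0

/-- The coordinates of `∂ (w k)`. -/
def koszulThree (z : Fin 3 → R) (p : Pair) : R :=
  if p.1 = (0, 1) then z 2 else if p.1 = (0, 2) then -z 1 else z 0

lemma sum_pair {M : Type*} [AddCommMonoid M] (f : Pair → M) : ∑ p, f p =
    f ⟨(0, 1), by decide⟩ + f ⟨(0, 2), by decide⟩ + f ⟨(1, 2), by decide⟩ := by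
  have : (Finset.univ : Finset Pair) =
      {⟨(0, 1), by decide⟩, ⟨(0, 2), by decide⟩, ⟨(1, 2), by decide⟩} := by decide
  rw [this, Finset.sum_insert (by decide), Finset.sum_insert (by decide), Finset.sum_singleton,
    add_assoc]

lemma sum_low_add_sum_high {M : Type*} [AddCommMonoid M] (f : Fin m → M) :
    ∑ k : Low m t, f k + ∑ i : High m t, f i = ∑ i, f i := by
  rw [← Fintype.sum_subtype_add_sum_subtype (fun i : Fin m => (i : ℕ) < t) f]
  congr 1
  exact Fintype.sum_equiv (Equiv.subtypeEquivRight fun i => by simp) _ _ fun i => rfl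

lemma bas_apply (b b' : Cell m t) [Decidable (b = b')] :
    bas R b b' = if b = b' then 1 else 0 := by
  classical
  rw [bas, Finsupp.single_apply]

variable (T : Matrix (Fin m) (Fin m) R) (c : Fin m → Fin m → Fin 3 → R) (z : Fin 3 → R)

lemma diff_single (b : Cell m t) (a : R) :
    diff T c z t (Finsupp.single b a) = a • diff T c z t (bas R b) := by
  simp [diff, bas]

lemma diff_one : diff T c z t (bas R .one) = 0 := by simp [diff, bas]

lemma diff_e (i : High m t) : diff T c z t (bas R (.e i)) = gen T i • bas R .one := by
  simp [diff, bas]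

lemma diff_u (k : Low m t) (l : Fin 3) :
    diff T c z t (bas R (.u k l)) = -(gen T k * z l) • bas R .one := by
  simp [diff, bas]

lemma diff_f (i : Fin m) : diff T c z t (bas R (.f i)) = ∑ j : High m t, T j i • bas R (.e j)
        - ∑ k : Low m t, ∑ l : Fin 3, c i k l • bas R (.u k l) := by
  simp [diff, bas]

lemma diff_v (k : Low m t) (p : Pair) : diff T c z t (bas R (.v k p)) =
    z p.1.1 • bas R (.u k p.1.2) - z p.1.2 • bas R (.u k p.1.1) := by
  simp [diff, bas]

lemma diff_g : diff T c z t (bas R .g) = ∑ i : Fin m, gen T i • bas R (.f i)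
        + ∑ k : Low m t, ∑ p : Pair, dOne T c k p.1.1 p.1.2 • bas R (.v k p) := by
  simp [diff, bas]

lemma diff_w (k : Low m t) : diff T c z t (bas R (.w k)) =
    ∑ p, koszulThree z p • bas R (.v k p) := by
  rw [sum_pair]
  simp [diff, bas, koszulThree, sub_eq_add_neg]

open scoped Classical in
lemma diff_apply (x : Res R m t) (b : Cell m t) : diff T c z t x b = match b with
    | .one => ∑ i : High m t, x (.e i) * gen T i - ∑ k : Low m t, ∑ l, x (.u k l) * (gen T k * z l)
    | .e j => ∑ i, T j i * x (.f i)
    | .u k l => ∑ p, x (.v k p) * koszulTwo z p l - ∑ i, c i k l * x (.f i)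
    | .f i => x .g * gen T i
    | .v k p => x .g * dOne T c k p.1.1 p.1.2 + x (.w k) * koszulThree z p
    | _ => 0 := by
  induction x using Finsupp.induction_linear with
  | zero => cases b <;> simp
  | add x y hx hy =>
    rw [map_add, Finsupp.add_apply, hx, hy]
    cases b <;> simp [add_mul, mul_add, Finset.sum_add_distrib] <;> ring
  | single a r =>
    rw [diff_single]
    cases a with
    | one => rw [diff_one]; cases b <;> simp
    | e i => rw [diff_e]; cases b <;> simp [bas_apply, Finsupp.single_apply]
    | u k l =>
      rw [diff_u]
      cases b <;> simp [bas_apply, Finsupp.single_apply]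
      simp [ite_and, Finset.sum_ite_eq]
    | f i =>
      rw [diff_f]
      cases b <;> simp [bas_apply, Finsupp.single_apply, mul_comm, ite_and]
    | v k p =>
      rw [diff_v]
      cases b <;> simp [bas_apply, Finsupp.single_apply, koszulTwo, ite_and]
      rename_i k' l'
      by_cases h : k = k' <;> simp [h]
    | g =>
      rw [diff_g]
      cases b <;> simp [bas_apply, ite_and]
    | w k =>
      rw [diff_w]
      cases b <;> simp [bas_apply, Finsupp.single_apply, ite_and]

end Complex

/-! ### The complex is a free resolution -/

section Resolution

variable {R : Type*} [CommRing R] {m t : ℕ}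

lemma mem_piece {n : ℕ} {x : Res R m t} : x ∈ piece R m t n ↔ ∀ b, b.deg ≠ n → x b = 0 :=
  Finsupp.mem_supported' _ _

lemma bas_mem_piece {n : ℕ} {b : Cell m t} (h : b.deg = n) : bas R b ∈ piece R m t n :=
  Finsupp.single_mem_supported _ _ h

lemma piece_eq_span (n : ℕ) :
    piece R m t n = Submodule.span R (bas R '' {b : Cell m t | b.deg = n}) :=
  Finsupp.supported_eq_span_single _ _

lemma piece_induction {n : ℕ} {p : Res R m t → Prop} (hb : ∀ b, b.deg = n → p (bas R b))
    (h0 : p 0) (hadd : ∀ x y, p x → p y → p (x + y)) (hsmul : ∀ (a : R) x, p x → p (a • x))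
    {x : Res R m t} (hx : x ∈ piece R m t n) : p x := by
  rw [piece_eq_span] at hx
  induction hx using Submodule.span_induction with
  | mem x hx => obtain ⟨b, hb', rfl⟩ := hx; exact hb b hb'
  | zero => exact h0
  | add x y _ _ hx hy => exact hadd x y hx hy
  | smul a x _ hx => exact hsmul a x hx

lemma deg_le_three (b : Cell m t) : b.deg ≤ 3 := by cases b <;> simp [Cell.deg]

lemma deg_eq_zero_iff (b : Cell m t) : b.deg = 0 ↔ b = .one := by cases b <;> simp [Cell.deg]

lemma isInternal_piece : DirectSum.IsInternal (piece R m t) := by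
  rw [DirectSum.isInternal_submodule_iff_iSupIndep_and_iSup_eq_top]
  constructor
  · intro n
    have h : ⨆ j, ⨆ _ : j ≠ n, piece R m t j ≤ Finsupp.supported R R {b : Cell m t | b.deg ≠ n} :=
      iSup₂_le fun j hj => Finsupp.supported_mono fun b hb h => hj (hb.symm.trans h)
    refine Disjoint.mono_right h (Finsupp.disjoint_supported_supported ?_)
    exact Set.disjoint_left.2 fun b hb hb' => hb' hb
  · unfold piece
    rw [← Finsupp.supported_iUnion, ← Finsupp.supported_univ]
    congr 1
    ext b
    simp

lemma free_piece (n : ℕ) : Module.Free R (piece R m t n) :=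
  Module.Free.of_equiv (Finsupp.supportedEquivFinsupp _).symm

lemma piece_eq_zero {n : ℕ} (hn : 3 < n) {x : Res R m t} (hx : x ∈ piece R m t n) : x = 0 := by
  ext b
  exact mem_piece.1 hx b (by have := deg_le_three b; omega)

lemma sum_mul_koszulTwo (A : Fin 3 → Fin 3 → R) (h0 : ∀ α, A α α = 0)
    (h : ∀ α β, A β α = -A α β) (z : Fin 3 → R) (l : Fin 3) :
    ∑ p : Pair, A p.1.1 p.1.2 * koszulTwo z p l = ∑ α, z α * A α l := by
  rw [sum_pair, Fin.sum_univ_three]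
  have h1 := h 0 1
  have h2 := h 0 2
  have h3 := h 1 2
  fin_cases l <;> simp [koszulTwo, h0, h1, h2, h3] <;> ring

lemma sum_koszulTwo_mul (z : Fin 3 → R) (p : Pair) : ∑ l, koszulTwo z p l * z l = 0 := by
  simp only [koszulTwo, sub_mul, ite_mul, zero_mul, Finset.sum_sub_distrib, Finset.sum_ite_eq,
    Finset.mem_univ, if_true]
  ring

lemma sum_koszulThree_mul (z : Fin 3 → R) (l : Fin 3) :
    ∑ p, koszulThree z p * koszulTwo z p l = 0 := by
  rw [sum_pair]
  fin_cases l <;> simp [koszulTwo, koszulThree] <;> ring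

variable (T : Matrix (Fin m) (Fin m) R) (c : Fin m → Fin m → Fin 3 → R) (z : Fin 3 → R)

lemma diff_apply_one (x : Res R m t) : diff T c z t x .one =
    ∑ i : High m t, x (.e i) * gen T i - ∑ k : Low m t, ∑ l, x (.u k l) * (gen T k * z l) :=
  diff_apply T c z x .one

lemma diff_apply_e (x : Res R m t) (j : High m t) :
    diff T c z t x (.e j) = ∑ i, T j i * x (.f i) := diff_apply T c z x (.e j)

lemma diff_apply_u (x : Res R m t) (k : Low m t) (l : Fin 3) : diff T c z t x (.u k l) =
    ∑ p, x (.v k p) * koszulTwo z p l - ∑ i, c i k l * x (.f i) := diff_apply T c z x (.u k l)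

lemma diff_apply_f (x : Res R m t) (i : Fin m) : diff T c z t x (.f i) = x .g * gen T i :=
  diff_apply T c z x (.f i)

lemma diff_apply_v (x : Res R m t) (k : Low m t) (p : Pair) : diff T c z t x (.v k p) =
    x .g * dOne T c k p.1.1 p.1.2 + x (.w k) * koszulThree z p := diff_apply T c z x (.v k p)

lemma diff_apply_g (x : Res R m t) : diff T c z t x .g = 0 := diff_apply T c z x .g

lemma diff_apply_w (x : Res R m t) (k : Low m t) : diff T c z t x (.w k) = 0 :=
  diff_apply T c z x (.w k)

lemma diff_mem_piece (n : ℕ) (x : Res R m t) (hx : x ∈ piece R m t (n + 1)) :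
    diff T c z t x ∈ piece R m t n := by
  rw [mem_piece] at hx ⊢
  intro b hb
  cases b <;> simp only [Cell.deg] at hb
  · rw [diff_apply_one]
    simp [hx (.e _) (by simp [Cell.deg]; omega), hx (.u _ _) (by simp [Cell.deg]; omega)]
  · rw [diff_apply_e]
    simp [hx (.f _) (by simp [Cell.deg]; omega)]
  · rw [diff_apply_u]
    simp [hx (.f _) (by simp [Cell.deg]; omega), hx (.v _ _) (by simp [Cell.deg]; omega)]
  · rw [diff_apply_f, hx .g (by simp [Cell.deg]; omega), zero_mul]
  · rw [diff_apply_v, hx .g (by simp [Cell.deg]; omega), hx (.w _) (by simp [Cell.deg]; omega)]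
    simp
  · rw [diff_apply_g]
  · rw [diff_apply_w]

lemma diff_eq_zero_of_mem_piece_zero (x : Res R m t) (hx : x ∈ piece R m t 0) :
    diff T c z t x = 0 := by
  refine piece_induction (p := fun x => diff T c z t x = 0) ?_ (map_zero _) ?_ ?_ hx
  · intro b hb
    rw [(deg_eq_zero_iff b).1 hb, diff_one]
  · intro x y hx hy; rw [map_add, hx, hy, add_zero]
  · intro a x hx; rw [map_smul, hx, smul_zero]

variable (hskew : ∀ i j, T j i = -T i j) (hdiag : ∀ i, T i i = 0)
  (hc : ∀ i j, T j i = ∑ l, c i j l * z l) (hc0 : ∀ k : Low m t, ∀ l, c k k l = 0)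

include hskew hdiag hc hc0 in
lemma diff_diff (x : Res R m t) : diff T c z t (diff T c z t x) = 0 := by
  ext b
  rw [Finsupp.zero_apply]
  cases b with
  | one =>
    rw [diff_apply_one]
    simp only [diff_apply_e, diff_apply_u]
    -- Weighting by z kills the Koszul part and turns the c i k l into T k i, so block k contributes
    -- as a basis vector e_k would.
    have h1 : ∀ k : Low m t, ∑ l, (∑ p, x (.v k p) * koszulTwo z p l - ∑ i, c i k l * x (.f i)) *
        (gen T k * z l) = -((∑ i, T k i * x (.f i)) * gen T k) := by
      intro k
      have h2 : ∑ l, (∑ p, x (.v k p) * koszulTwo z p l) * (gen T k * z l) = 0 := by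
        simp only [Finset.sum_mul]
        rw [Finset.sum_comm]
        refine Finset.sum_eq_zero fun p _ => ?_
        rw [← mul_zero (x (.v k p) * gen T k), ← sum_koszulTwo_mul z p, Finset.mul_sum]
        exact Finset.sum_congr rfl fun l _ => by ring
      simp only [sub_mul, Finset.sum_sub_distrib]
      rw [h2, zero_sub, neg_inj]
      simp only [hc _ (k : Fin m), Finset.sum_mul]
      rw [Finset.sum_comm]
      exact Finset.sum_congr rfl fun i _ => Finset.sum_congr rfl fun l _ => by ring
    simp only [h1, Finset.sum_neg_distrib, sub_neg_eq_add]
    rw [add_comm, sum_low_add_sum_high (t := t) fun k => (∑ i, T k i * x (.f i)) * gen T k]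
    simp only [Finset.sum_mul]
    rw [Finset.sum_comm]
    refine Finset.sum_eq_zero fun i _ => ?_
    rw [← mul_zero (-x (.f i)), ← sum_row_mul_gen T hskew hdiag i, Finset.mul_sum]
    exact Finset.sum_congr rfl fun j _ => by rw [hskew i j]; ring
  | e j =>
    rw [diff_apply_e]
    simp only [diff_apply_f]
    rw [← mul_zero (x .g), ← sum_row_mul_gen T hskew hdiag j, Finset.mul_sum]
    exact Finset.sum_congr rfl fun j _ => by ring
  | u k l =>
    rw [diff_apply_u]
    simp only [diff_apply_f, diff_apply_v, add_mul, Finset.sum_add_distrib, mul_assoc,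
      ← Finset.mul_sum]
    rw [sum_koszulThree_mul, sum_mul_koszulTwo (dOne T c k)
      (dOne_pair_self T hskew hdiag c k) (dOne_swap_pair T hskew hdiag c k),
      sum_mul_dOne T hskew hdiag c z hc (hc0 k), mul_zero, add_zero, sub_eq_zero, Finset.mul_sum]
    exact Finset.sum_congr rfl fun j _ => by ring
  | f i => rw [diff_apply_f, diff_apply_g, zero_mul]
  | v k p => rw [diff_apply_v, diff_apply_g, diff_apply_w]; ring
  | g => rw [diff_apply_g]
  | w k => rw [diff_apply_w]

/-- The coordinates `p`, `q`, `r` at `(0, 1)`, `(0, 2)`, `(1, 2)`. -/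
def pairCoord (p q r : R) (x : Pair) : R :=
  if x.1 = (0, 1) then p else if x.1 = (0, 2) then q else r

lemma pairCoord_koszulTwo (p q r : R) (l : Fin 3) :
    ∑ x, pairCoord p q r x * koszulTwo z x l =
      ![-(z 1 * p) - z 2 * q, z 0 * p - z 2 * r, z 0 * q + z 1 * r] l := by
  rw [sum_pair]
  fin_cases l <;> simp [koszulTwo, pairCoord] <;> ring

variable (hz : HasRegularTriple (Ideal.span (Set.range z))) (hI : HasRegularTriple (pfIdeal T))

include hskew hdiag hc hz hI in
lemma diff_exact_one (x : Res R m t) (hx : x ∈ piece R m t 1) (hdx : diff T c z t x = 0) :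
    ∃ y ∈ piece R m t 2, diff T c z t y = x := by
  rw [mem_piece] at hx
  -- The image of x under u^k_l ↦ -z_l e_k, a cycle of the pfaffian complex.
  let A : Fin m → R := fun j => if h : (j : ℕ) < t then -∑ l, x (.u ⟨j, h⟩ l) * z l
    else x (.e ⟨j, not_lt.1 h⟩)
  have hAl : ∀ k : Low m t, A k = -∑ l, x (.u k l) * z l := fun k => by simp [A, k.2]
  have hAh : ∀ k : High m t, A k = x (.e k) := fun k => by simp [A, not_lt.2 k.2]
  have hA : ∑ j, A j * gen T j = 0 := by
    have h := congrArg (fun y => y (.one : Cell m t)) hdx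
    simp only [diff_apply_one, Finsupp.zero_apply] at h
    rw [← h, ← sum_low_add_sum_high (t := t) fun j => A j * gen T j]
    simp only [hAl, hAh]
    rw [sub_eq_add_neg, add_comm]
    congr 1
    rw [← Finset.sum_neg_distrib]
    refine Finset.sum_congr rfl fun k _ => ?_
    rw [neg_mul, Finset.sum_mul]
    congr 1
    exact Finset.sum_congr rfl fun l _ => by ring
  have hrow : ∀ q, ∑ r, T q r * gen T r = 0 := sum_row_mul_gen T hskew hdiag
  obtain ⟨f, hf⟩ := exists_mulVec_eq hI hrow (gen_smul_mem_range T hskew hdiag)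
    (gen_commute_mod T hskew hdiag) A hA
  -- After subtracting the boundary of the lift f, the block k of x is a Koszul cycle.
  have hb : ∀ k : Low m t, ∑ l, z l * (x (.u k l) + ∑ i, c i k l * f i) = 0 := by
    intro k
    have h1 := hf k
    rw [hAl] at h1
    simp only [mul_add, Finset.sum_add_distrib]
    have h2 : ∑ l, z l * ∑ i, c i k l * f i = ∑ r, T k r * f r := by
      simp only [hc _ (k : Fin m), Finset.sum_mul, Finset.mul_sum]
      rw [Finset.sum_comm]
      exact Finset.sum_congr rfl fun i _ => Finset.sum_congr rfl fun l _ => by ring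
    rw [h2, ← h1, ← sub_eq_add_neg, sub_eq_zero]
    exact Finset.sum_congr rfl fun l _ => by ring
  choose p q r h0 h1 h2 using fun k => koszul_exact_one hz _ (hb k)
  refine ⟨ofCoord fun b => match b with
    | .f i => f i
    | .v k x => pairCoord (p k) (q k) (r k) x
    | _ => 0, ?_, ?_⟩
  · rw [mem_piece]
    intro b hb
    cases b <;> simp [Cell.deg] at hb ⊢
  · ext b
    cases b with
    | one => rw [diff_apply_one]; simp [hx .one (by simp [Cell.deg])]
    | e j => rw [diff_apply_e]; simp only [ofCoord_apply]; rw [← hAh, hf]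
    | u k l =>
      rw [diff_apply_u]
      simp only [ofCoord_apply]
      rw [pairCoord_koszulTwo, sub_eq_iff_eq_add]
      fin_cases l
      · exact (h0 k).symm
      · exact (h1 k).symm
      · exact (h2 k).symm
    | f i => rw [diff_apply_f, hx (.f i) (by simp [Cell.deg])]; simp
    | v k p => rw [diff_apply_v, hx (.v k p) (by simp [Cell.deg])]; simp
    | g => rw [diff_apply_g, hx .g (by simp [Cell.deg])]
    | w k => rw [diff_apply_w, hx (.w k) (by simp [Cell.deg])]

include hskew hdiag hc hc0 hz hI in
lemma diff_exact_two (x : Res R m t) (hx : x ∈ piece R m t 2) (hdx : diff T c z t x = 0) :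
    ∃ y ∈ piece R m t 3, diff T c z t y = x := by
  rw [mem_piece] at hx
  have he : ∀ j : High m t, ∑ i, T j i * x (.f i) = 0 := fun j => by
    rw [← diff_apply_e T c z, hdx]; rfl
  have hu : ∀ (k : Low m t) l,
      ∑ p, x (.v k p) * koszulTwo z p l = ∑ i, c i k l * x (.f i) := fun k l => by
    rw [← sub_eq_zero, ← diff_apply_u T c z, hdx]; rfl
  -- For a low index j, pair the u-coordinates of ∂x with z: the v-part drops out and row j of T
  -- applied to the f-part remains.
  have hT : ∀ j, ∑ i, T j i * x (.f i) = 0 := by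
    intro j
    by_cases h : (j : ℕ) < t
    · have h1 : ∑ l, (∑ p, x (.v ⟨j, h⟩ p) * koszulTwo z p l) * z l = 0 := by
        simp only [Finset.sum_mul]
        rw [Finset.sum_comm]
        refine Finset.sum_eq_zero fun p _ => ?_
        simp only [mul_assoc]
        rw [← Finset.mul_sum, sum_koszulTwo_mul, mul_zero]
      simp only [hu] at h1
      rw [← h1]
      simp only [hc _ j, Finset.sum_mul]
      rw [Finset.sum_comm]
      exact Finset.sum_congr rfl fun i _ => Finset.sum_congr rfl fun l _ => by ring
    · exact he ⟨j, not_lt.1 h⟩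
  obtain ⟨s, hs⟩ := exists_smul_of_mulVec_eq_zero hI (gen_commute_mod T hskew hdiag) _ hT
  -- The f-part of x is that of s ∂g. The difference x - s ∂g has only v-coordinates, which form
  -- Koszul cycles and hence are multiples of the ∂w^k.
  have hk : ∀ (k : Low m t) l,
      ∑ p : Pair, (x (.v k p) - s * dOne T c k p.1.1 p.1.2) * koszulTwo z p l = 0 := by
    intro k l
    simp only [sub_mul, Finset.sum_sub_distrib, mul_assoc, ← Finset.mul_sum]
    rw [hu, sum_mul_koszulTwo (dOne T c k)
      (dOne_pair_self T hskew hdiag c k) (dOne_swap_pair T hskew hdiag c k),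
      sum_mul_dOne T hskew hdiag c z hc (hc0 k), sub_eq_zero, Finset.mul_sum]
    exact Finset.sum_congr rfl fun i _ => by rw [hs]; ring
  have hw : ∀ k : Low m t, ∃ w, ∀ p : Pair,
      x (.v k p) - s * dOne T c k p.1.1 p.1.2 = w * koszulThree z p := by
    intro k
    set g : Pair → R := fun p => x (.v k p) - s * dOne T c k p.1.1 p.1.2 with hg
    have hg' : g = pairCoord (g ⟨(0, 1), by decide⟩) (g ⟨(0, 2), by decide⟩)
        (g ⟨(1, 2), by decide⟩) := by
      funext ⟨⟨a, b⟩, hab⟩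
      fin_cases a <;> fin_cases b <;> first | exact absurd hab (by decide) | rfl
    have h := hk k
    change ∀ l, ∑ p, g p * koszulTwo z p l = 0 at h
    rw [hg'] at h
    simp only [pairCoord_koszulTwo] at h
    obtain ⟨w, h1, h2, h3⟩ := koszul_exact_two hz (h 0) (h 1) (h 2)
    refine ⟨w, fun p => ?_⟩
    change g p = _
    rw [hg', koszulThree, pairCoord, h1, h2, h3]
    split_ifs <;> ring
  choose w hw using hw
  refine ⟨ofCoord fun b => match b with
    | .g => s
    | .w k => w k
    | _ => 0, ?_, ?_⟩
  · rw [mem_piece]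
    intro b hb
    cases b <;> simp [Cell.deg] at hb ⊢
  · ext b
    cases b with
    | one => rw [diff_apply_one]; simp [hx .one (by simp [Cell.deg])]
    | e j => rw [diff_apply_e]; simp [hx (.e j) (by simp [Cell.deg])]
    | u k l => rw [diff_apply_u]; simp [hx (.u k l) (by simp [Cell.deg])]
    | f i => rw [diff_apply_f, hs]; rfl
    | v k p => rw [diff_apply_v]; simp only [ofCoord_apply]; rw [← hw]; ring
    | g => rw [diff_apply_g, hx .g (by simp [Cell.deg])]
    | w k => rw [diff_apply_w, hx (.w k) (by simp [Cell.deg])]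

include hz hI in
lemma diff_injective_three (x : Res R m t) (hx : x ∈ piece R m t 3) (hdx : diff T c z t x = 0) :
    x = 0 := by
  rw [mem_piece] at hx
  have hg : x .g = 0 := eq_zero_of_mul_eq_zero hI fun q => by
    rw [← diff_apply_f T c z, hdx]; rfl
  have hw : ∀ k, x (.w k) = 0 := fun k => eq_zero_of_mul_eq_zero hz fun q => by
    have h : ∀ p, x (.w k) * koszulThree z p = 0 := fun p => by
      have := diff_apply_v T c z x k p
      rw [hdx, hg] at this
      simpa using this.symm
    have h01 := h ⟨(0, 1), by decide⟩
    have h02 := h ⟨(0, 2), by decide⟩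
    have h12 := h ⟨(1, 2), by decide⟩
    simp [koszulThree] at h01 h02 h12
    fin_cases q
    · exact h12
    · exact h02
    · exact h01
  ext b
  cases b with
  | g => exact hg
  | w k => exact hw k
  | _ => exact hx _ (by simp [Cell.deg])

lemma range_diff_one (a : R) : (∃ y ∈ piece R m t 1, diff T c z t y = a • bas R .one) ↔
    a ∈ trimIdeal T (Ideal.span (Set.range z)) t := by
  have hmem : ∀ i : Fin m, t ≤ (i : ℕ) →
      gen T i ∈ trimIdeal T (Ideal.span (Set.range z)) t := fun i hi =>
    Ideal.mem_sup_right (Ideal.subset_span ⟨i, hi, rfl⟩)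
  have hmem' : ∀ (k : Low m t) l,
      gen T k * z l ∈ trimIdeal T (Ideal.span (Set.range z)) t := fun k l =>
    Ideal.mem_sup_left (Ideal.mem_iSup_of_mem k (Ideal.mul_mem_mul
      (Ideal.mem_span_singleton_self _) (Ideal.subset_span ⟨l, rfl⟩)))
  have hsingle : ∀ y : Res R m t, y ∈ piece R m t 1 →
      diff T c z t y = diff T c z t y .one • bas R .one := fun y hy => by
    classical
    have h := mem_piece.1 (diff_mem_piece T c z 0 y hy)
    ext b
    by_cases hb : b = .one
    · subst hb; simp [bas]
    · rw [h b (fun h' => hb ((deg_eq_zero_iff b).1 h'))]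
      simp [bas, Ne.symm hb]
  constructor
  · rintro ⟨y, -, hy⟩
    have h := congrArg (fun y => y (.one : Cell m t)) hy
    simp only [diff_apply_one] at h
    have ha : a = (a • bas R (.one : Cell m t)) .one := by simp [bas]
    rw [ha, ← h]
    exact Ideal.sub_mem _ (Ideal.sum_mem _ fun i _ => Ideal.mul_mem_left _ _ (hmem i i.2))
      (Ideal.sum_mem _ fun k _ => Ideal.sum_mem _ fun l _ => Ideal.mul_mem_left _ _ (hmem' k l))
  -- The scalars a for which a • 1 is a boundary form an ideal, so generators suffice.
  · let N : Submodule R R := ((piece R m t 1).map (diff T c z t)).comap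
      (LinearMap.toSpanSingleton R (Res R m t) (bas R .one))
    have hN : ∀ a, a ∈ N ↔ ∃ y ∈ piece R m t 1, diff T c z t y = a • bas R .one := fun a => by
      simp [N]
    intro ha
    rw [← hN]
    suffices h : trimIdeal T (Ideal.span (Set.range z)) t ≤ N from h ha
    refine sup_le (iSup_le fun k => ?_) (Ideal.span_le.2 ?_)
    · rw [Ideal.span_mul_span, Ideal.span_le]
      rintro _ hx
      obtain ⟨_, rfl, _, ⟨l, rfl⟩, rfl⟩ := hx
      refine (hN _).2 ⟨-bas R (.u k l), Submodule.neg_mem _ (bas_mem_piece rfl), ?_⟩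
      rw [map_neg, diff_u, neg_smul, neg_neg]
    · rintro _ ⟨i, hi, rfl⟩
      exact (hN _).2 ⟨bas R (.e ⟨i, hi⟩), bas_mem_piece rfl, diff_e ..⟩

include hskew hdiag hc hc0 hz hI in
theorem isFreeResolution_diff : IsFreeResolution (piece R m t) (diff T c z t) (bas R .one)
    (trimIdeal T (Ideal.span (Set.range z)) t) where
  isInternal := isInternal_piece
  d_zero := diff_eq_zero_of_mem_piece_zero T c z
  d_succ := diff_mem_piece T c z
  d_d := diff_diff T c z hskew hdiag hc hc0
  free := free_piece
  exact_succ n x hx hdx := by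
    match n with
    | 0 => exact diff_exact_one T c z hskew hdiag hc hz hI x hx hdx
    | 1 => exact diff_exact_two T c z hskew hdiag hc hc0 hz hI x hx hdx
    | 2 =>
      obtain rfl := diff_injective_three T c z hz hI x hx hdx
      exact ⟨0, Submodule.zero_mem _, map_zero _⟩
    | n + 3 =>
      obtain rfl := piece_eq_zero (by omega) hx
      exact ⟨0, Submodule.zero_mem _, map_zero _⟩
  one_mem := bas_mem_piece rfl
  surjective_zero x hx := by
    refine ⟨x .one, 0, Submodule.zero_mem _, ?_⟩
    rw [map_zero, add_zero]
    refine piece_induction (p := fun x => x = x .one • bas R (.one : Cell m t)) ?_ ?_ ?_ ?_ hx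
    · intro b hb
      rw [(deg_eq_zero_iff b).1 hb]
      simp [bas]
    · simp
    · intro x y hx hy
      rw [Finsupp.add_apply, add_smul, ← hx, ← hy]
    · intro a x hx
      rw [Finsupp.smul_apply, smul_assoc, ← hx]
  kernel_zero := range_diff_one T c z

end Resolution

/-! ### DG algebra structures on resolutions of length three -/

section DGAlgebra

variable {R : Type*} [CommRing R] {m t : ℕ}

lemma eq_on_piece {N : Type*} [AddCommMonoid N] [Module R N] {n : ℕ} {f g : Res R m t →ₗ[R] N}
    (h : ∀ b, b.deg = n → f (bas R b) = g (bas R b)) {x : Res R m t} (hx : x ∈ piece R m t n) :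
    f x = g x := by
  refine piece_induction (p := fun x => f x = g x) h (by simp) ?_ ?_ hx
  · intro x y hx hy; rw [map_add, map_add, hx, hy]
  · intro a x hx; rw [map_smul, map_smul, hx]

lemma eq_on_pieces {N : Type*} [AddCommMonoid N] [Module R N] {p q : ℕ}
    {f g : Res R m t →ₗ[R] Res R m t →ₗ[R] N}
    (h : ∀ a b, a.deg = p → b.deg = q → f (bas R a) (bas R b) = g (bas R a) (bas R b))
    {x y : Res R m t} (hx : x ∈ piece R m t p) (hy : y ∈ piece R m t q) : f x y = g x y :=
  eq_on_piece (f := f.flip y) (g := g.flip y)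
    (fun a ha => eq_on_piece (fun b hb => h a b ha hb) hy) hx

lemma hom_ext_bas {N : Type*} [AddCommMonoid N] [Module R N] {f g : Res R m t →ₗ[R] N}
    (h : ∀ b, f (bas R b) = g (bas R b)) : f = g :=
  Finsupp.lhom_ext' fun b => LinearMap.ext_ring (h b)

/-- The bilinear map with given values on the basis. -/
noncomputable def bilin (p : Cell m t → Cell m t → Res R m t) :
    Res R m t →ₗ[R] Res R m t →ₗ[R] Res R m t :=
  Finsupp.linearCombination R fun a => Finsupp.linearCombination R (p a)

lemma bilin_bas (p : Cell m t → Cell m t → Res R m t) (a b : Cell m t) :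
    bilin p (bas R a) (bas R b) = p a b := by simp [bilin, bas]

/-- The products of basis elements, given those of elements of degrees one and one, and those of
elements of degrees one and two. -/
noncomputable def prodTable (p q : Cell m t → Cell m t → Res R m t) (a b : Cell m t) : Res R m t :=
  if a.deg = 0 then bas R b
  else if b.deg = 0 then bas R a
  else if a.deg = 1 ∧ b.deg = 1 then p a b
  else if a.deg = 1 ∧ b.deg = 2 then q a b
  else if a.deg = 2 ∧ b.deg = 1 then q b a
  else 0

variable {d : Res R m t →ₗ[R] Res R m t} {J : Ideal R}

/-- Only the products of degrees one and two have to be constructed, and for these exactness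
suffices. Products of positive degree elements vanish in total degree at least four, and equations
in degree three are tested after the injective ∂₃. -/
theorem exists_isDGAlgebra (hd : IsFreeResolution (piece R m t) d (bas R .one) J)
    (ε : Cell m t → R) (hε : ∀ a, a.deg = 1 → d (bas R a) = ε a • bas R .one)
    (p : Cell m t → Cell m t → Res R m t)
    (hp_mem : ∀ a b, a.deg = 1 → b.deg = 1 → p a b ∈ piece R m t 2)
    (hp_self : ∀ a, a.deg = 1 → p a a = 0)
    (hp_swap : ∀ a b, a.deg = 1 → b.deg = 1 → p a b = -p b a)
    (hp_d : ∀ a b, a.deg = 1 → b.deg = 1 → d (p a b) = ε a • bas R b - ε b • bas R a) :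
    ∃ mul : Res R m t →ₗ[R] Res R m t →ₗ[R] Res R m t,
      IsDGAlgebra (piece R m t) d (bas R .one) mul ∧
      ∀ a b, a.deg = 1 → b.deg = 1 → mul (bas R a) (bas R b) = p a b := by
  have hinj : ∀ x ∈ piece R m t 3, d x = 0 → x = 0 := by
    intro x hx hdx
    obtain ⟨y, hy, rfl⟩ := hd.exact_succ 2 x hx hdx
    rw [piece_eq_zero (by norm_num) hy, map_zero]
  set E : Res R m t →ₗ[R] R := Finsupp.linearCombination R ε with hE
  have hEb : ∀ a, E (bas R a) = ε a := fun a => by simp [hE, bas]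
  have hdE : ∀ x ∈ piece R m t 1, d x = E x • bas R .one := fun x hx =>
    eq_on_piece (g := E.smulRight (bas R .one))
      (fun a ha => by rw [hε a ha, LinearMap.smulRight_apply, hEb]) hx
  have hEd : ∀ x ∈ piece R m t 2, E (d x) = 0 := by
    intro x hx
    have h := hdE _ (hd.d_succ 1 x hx)
    rw [hd.d_d] at h
    have := congrArg (fun y => y (.one : Cell m t)) h
    simpa [bas] using this.symm
  have hP : ∀ x ∈ piece R m t 1, ∀ y ∈ piece R m t 1, d (bilin p x y) = E x • y - E y • x := by
    intro x hx y hy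
    rw [eq_sub_iff_add_eq]
    refine eq_on_pieces (f := (bilin p).compr₂ d + ((LinearMap.lsmul R (Res R m t)).comp E).flip)
      (g := (LinearMap.lsmul R (Res R m t)).comp E) ?_ hx hy
    intro a b ha hb
    simp only [LinearMap.compr₂_apply, bilin_bas, LinearMap.add_apply, LinearMap.comp_apply,
      LinearMap.flip_apply, LinearMap.lsmul_apply, hEb]
    exact eq_sub_iff_add_eq.1 (hp_d a b ha hb)
  -- The Leibniz rule prescribes the boundary of the product; the prescribed element is a cycle
  -- because E ∘ d = 0 in degree two.
  have hq : ∀ a b, ∃ q, a.deg = 1 → b.deg = 2 → q ∈ piece R m t 3 ∧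
      d q = ε a • bas R b - bilin p (bas R a) (d (bas R b)) := by
    intro a b
    by_cases ha : a.deg = 1
    · by_cases hb : b.deg = 2
      · have hdb := hd.d_succ 1 _ (bas_mem_piece (R := R) hb)
        have hm : bilin p (bas R a) (d (bas R b)) ∈ piece R m t 2 :=
          piece_induction (p := fun y => bilin p (bas R a) y ∈ piece R m t 2)
            (fun b' hb' => by rw [bilin_bas]; exact hp_mem a b' ha hb')
            (by simp) (fun x y hx hy => by rw [map_add]; exact Submodule.add_mem _ hx hy)
            (fun r x hx => by rw [map_smul]; exact Submodule.smul_mem _ _ hx) hdb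
        obtain ⟨q, hq, hdq⟩ := hd.exact_succ 1 (ε a • bas R b - bilin p (bas R a) (d (bas R b)))
          (Submodule.sub_mem _ (Submodule.smul_mem _ _ (bas_mem_piece hb)) hm) (by
            rw [map_sub, map_smul, hP _ (bas_mem_piece ha) _ hdb, hEd _ (bas_mem_piece hb), hEb]
            simp)
        exact ⟨q, fun _ _ => ⟨hq, hdq⟩⟩
      · exact ⟨0, fun _ h => absurd h hb⟩
    · exact ⟨0, fun h => absurd h ha⟩
  choose q hq_mem hq_d using hq
  set M := bilin (prodTable p q) with hM
  have hMb : ∀ a b, M (bas R a) (bas R b) = prodTable p q a b := bilin_bas _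
  have hdeg : ∀ a : Cell m t, a.deg = 0 ∨ a.deg = 1 ∨ a.deg = 2 ∨ a.deg = 3 := fun a => by
    have := deg_le_three a
    omega
  have hone : ∀ x, M (bas R .one) x = x := by
    intro x
    have : M (bas R .one) = LinearMap.id := hom_ext_bas fun b => by
      rw [hMb]; simp [prodTable, Cell.deg]
    rw [this, LinearMap.id_apply]
  have hone' : ∀ x, M x (bas R .one) = x := by
    intro x
    have : M.flip (bas R .one) = LinearMap.id := hom_ext_bas fun b => by
      rw [LinearMap.flip_apply, hMb, LinearMap.id_apply, prodTable]
      split_ifs with h h'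
      · rw [(deg_eq_zero_iff b).1 h]
      · rfl
      all_goals exact absurd rfl h'
    rw [← LinearMap.flip_apply, this, LinearMap.id_apply]
  have hmem_bas : ∀ a b, prodTable p q a b ∈ piece R m t (a.deg + b.deg) := by
    intro a b
    unfold prodTable
    split_ifs with h1 h2 h3 h4 h5
    · exact bas_mem_piece (by omega)
    · exact bas_mem_piece (by omega)
    · rw [h3.1, h3.2]; exact hp_mem a b h3.1 h3.2
    · rw [h4.1, h4.2]; exact hq_mem a b h4.1 h4.2
    · rw [h5.1, h5.2]; exact hq_mem b a h5.2 h5.1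
    · exact Submodule.zero_mem _
  have hmem : ∀ i j, ∀ x ∈ piece R m t i, ∀ y ∈ piece R m t j, M x y ∈ piece R m t (i + j) := by
    intro i j x hx y hy
    refine piece_induction (p := fun x => M x y ∈ piece R m t (i + j)) ?_ (by simp)
      (fun x y hx hy => by rw [map_add]; exact Submodule.add_mem _ hx hy)
      (fun r x hx => by rw [map_smul]; exact Submodule.smul_mem _ _ hx) hx
    intro a ha
    refine piece_induction (p := fun y => M (bas R a) y ∈ piece R m t (i + j)) ?_ (by simp)
      (fun x y hx hy => by rw [map_add]; exact Submodule.add_mem _ hx hy)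
      (fun r x hx => by rw [map_smul]; exact Submodule.smul_mem _ _ hx) hy
    intro b hb
    rw [hMb, ← ha, ← hb]
    exact hmem_bas a b
  have hzero : ∀ i j, 3 < i + j → ∀ x ∈ piece R m t i, ∀ y ∈ piece R m t j, M x y = 0 :=
    fun i j hij x hx y hy => piece_eq_zero hij (hmem i j x hx y hy)
  have hcomm_bas : ∀ a b, prodTable p q a b = (-1 : R) ^ (a.deg * b.deg) • prodTable p q b a := by
    intro a b
    rcases hdeg a with ha | ha | ha | ha <;> rcases hdeg b with hb | hb | hb | hb <;>
      simp [prodTable, ha, hb]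
    · rw [(deg_eq_zero_iff a).1 ha, (deg_eq_zero_iff b).1 hb]
    · exact hp_swap a b ha hb
  have hcomm : ∀ i j, ∀ x ∈ piece R m t i, ∀ y ∈ piece R m t j,
      M x y = (-1 : R) ^ (i * j) • M y x := by
    intro i j x hx y hy
    refine eq_on_pieces (f := M) (g := (-1 : R) ^ (i * j) • M.flip) ?_ hx hy
    intro a b ha hb
    rw [LinearMap.smul_apply, LinearMap.smul_apply, LinearMap.flip_apply, hMb, hMb, hcomm_bas, ha,
      hb]
  have hMp : ∀ a b, a.deg = 1 → b.deg = 1 → M (bas R a) (bas R b) = p a b := by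
    intro a b ha hb
    rw [hMb]
    simp [prodTable, ha, hb]
  have hMP : ∀ x ∈ piece R m t 1, ∀ y ∈ piece R m t 1, M x y = bilin p x y := fun x hx y hy =>
    eq_on_pieces (fun a b ha hb => by rw [hMp a b ha hb, bilin_bas]) hx hy
  have h11 : ∀ x ∈ piece R m t 1, ∀ y ∈ piece R m t 1, d (M x y) = E x • y - E y • x := by
    intro x hx y hy
    rw [hMP x hx y hy, hP x hx y hy]
  have h12 : ∀ x ∈ piece R m t 1, ∀ y ∈ piece R m t 2, d (M x y) = E x • y - M x (d y) := by
    intro x hx y hy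
    rw [eq_sub_iff_add_eq]
    refine eq_on_pieces (f := M.compr₂ d + M.compl₂ d)
      (g := (LinearMap.lsmul R (Res R m t)).comp E) ?_ hx hy
    intro a b ha hb
    simp only [LinearMap.compr₂_apply, LinearMap.add_apply, LinearMap.comp_apply,
      LinearMap.lsmul_apply, LinearMap.compl₂_apply, hEb]
    rw [← eq_sub_iff_add_eq, hMP _ (bas_mem_piece ha) _ (hd.d_succ 1 _ (bas_mem_piece hb)),
      ← hq_d a b ha hb, hMb]
    simp [prodTable, ha, hb]
  -- This relation and `h22` are the Leibniz rule in total degree four, where the product itself is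
  -- zero.
  have h13 : ∀ x ∈ piece R m t 1, ∀ y ∈ piece R m t 3, M x (d y) = E x • y := by
    intro x hx y hy
    have hdy := hd.d_succ 2 y hy
    rw [← sub_eq_zero]
    apply hinj
    · exact Submodule.sub_mem _ (hmem 1 2 x hx _ hdy) (Submodule.smul_mem _ _ hy)
    · rw [map_sub, h12 x hx _ hdy, hd.d_d, map_zero, sub_zero, map_smul, sub_self]
  have hcomm12 : ∀ x ∈ piece R m t 1, ∀ y ∈ piece R m t 2, M y x = M x y := fun x hx y hy => by
    simpa using hcomm 2 1 y hy x hx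
  have hcomm11 : ∀ x ∈ piece R m t 1, ∀ y ∈ piece R m t 1, M y x = -M x y := fun x hx y hy => by
    simpa using hcomm 1 1 y hy x hx
  have h22 : ∀ x ∈ piece R m t 2, ∀ y ∈ piece R m t 2, M (d x) y + M x (d y) = 0 := by
    intro x hx y hy
    have hdx := hd.d_succ 1 x hx
    have hdy := hd.d_succ 1 y hy
    apply hinj
    · exact Submodule.add_mem _ (hmem 1 2 _ hdx y hy) (hmem 2 1 x hx _ hdy)
    · rw [map_add, hcomm12 _ hdy x hx, h12 _ hdx y hy, h12 _ hdy x hx, hEd x hx, hEd y hy,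
        hcomm11 _ hdy _ hdx]
      simp
  have hleib : ∀ i j, ∀ x ∈ piece R m t i, ∀ y ∈ piece R m t j,
      d (M x y) = M (d x) y + (-1 : R) ^ i • M x (d y) := by
    intro i j x hx y hy
    have hdx : ∀ n, i = n + 1 → d x ∈ piece R m t n := fun n h => hd.d_succ n x (h ▸ hx)
    have hdy : ∀ n, j = n + 1 → d y ∈ piece R m t n := fun n h => hd.d_succ n y (h ▸ hy)
    by_cases hi0 : i = 0
    · subst hi0
      rw [hd.d_zero x hx]
      have := eq_on_piece (f := M.compr₂ d) (g := M.compl₂ d) (fun a ha => by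
        rw [(deg_eq_zero_iff a).1 ha]
        exact LinearMap.ext fun y => by simp [hone]) hx
      simpa using congrArg (fun f => f y) this
    by_cases hj0 : j = 0
    · subst hj0
      rw [hd.d_zero y hy]
      have := eq_on_piece (f := M.flip.compr₂ d) (g := M.flip.compl₂ d) (fun a ha => by
        rw [(deg_eq_zero_iff a).1 ha]
        exact LinearMap.ext fun y => by simp [hone']) hy
      simpa using congrArg (fun f => f x) this
    by_cases h5 : 5 ≤ i + j
    · obtain ⟨i, rfl⟩ := Nat.exists_eq_succ_of_ne_zero hi0
      obtain ⟨j, rfl⟩ := Nat.exists_eq_succ_of_ne_zero hj0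
      rw [hzero _ _ (by omega) x hx y hy, hzero _ _ (by omega) _ (hdx i rfl) y hy,
        hzero _ _ (by omega) x hx _ (hdy j rfl)]
      simp
    have hEone : ∀ x ∈ piece R m t 1, ∀ y, M (d x) y = E x • y := fun x hx y => by
      rw [hdE x hx, map_smul, LinearMap.smul_apply, hone]
    have hEone' : ∀ y ∈ piece R m t 1, ∀ x, M x (d y) = E y • x := fun y hy x => by
      rw [hdE y hy, map_smul, hone']
    have hcases : (i = 1 ∧ j = 1) ∨ (i = 1 ∧ j = 2) ∨ (i = 2 ∧ j = 1) ∨ (i = 1 ∧ j = 3) ∨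
      (i = 3 ∧ j = 1) ∨ (i = 2 ∧ j = 2) := by omega
    rcases hcases with ⟨rfl, rfl⟩ | ⟨rfl, rfl⟩ | ⟨rfl, rfl⟩ | ⟨rfl, rfl⟩ | ⟨rfl, rfl⟩ | ⟨rfl, rfl⟩
    · rw [h11 x hx y hy, hEone x hx, hEone' y hy]
      simp [sub_eq_add_neg]
    · rw [h12 x hx y hy, hEone x hx]
      simp [sub_eq_add_neg]
    · rw [hcomm12 y hy x hx, h12 y hy x hx, hEone' y hy, hcomm11 y hy _ (hdx 1 rfl)]
      simp [sub_eq_add_neg, add_comm]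
    · rw [hzero 1 3 (by norm_num) x hx y hy, hEone x hx, h13 x hx y hy]
      simp
    · rw [hzero 3 1 (by norm_num) x hx y hy, hEone' y hy, hcomm12 y hy _ (hdx 2 rfl), h13 y hy x hx]
      simp [pow_succ]
    · rw [hzero 2 2 (by norm_num) x hx y hy, map_zero]
      simpa using (h22 x hx y hy).symm
  -- If some factor has degree zero it is a multiple of the unit, and beyond total degree three both
  -- sides vanish. Three factors of degree one remain, and there the boundaries agree.
  have hassoc : ∀ x y w, M (M x y) w = M x (M y w) := by
    have hbas : ∀ a b e, M (M (bas R a) (bas R b)) (bas R e) =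
        M (bas R a) (M (bas R b) (bas R e)) := by
      intro a b e
      by_cases ha : a.deg = 0
      · rw [(deg_eq_zero_iff a).1 ha, hone, hone]
      by_cases hb : b.deg = 0
      · rw [(deg_eq_zero_iff b).1 hb, hone, hone']
      by_cases he : e.deg = 0
      · rw [(deg_eq_zero_iff e).1 he, hone', hone']
      have ha' := bas_mem_piece (R := R) (rfl : a.deg = a.deg)
      have hb' := bas_mem_piece (R := R) (rfl : b.deg = b.deg)
      have he' := bas_mem_piece (R := R) (rfl : e.deg = e.deg)
      by_cases h : 3 < a.deg + b.deg + e.deg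
      · rw [hzero _ _ h _ (hmem _ _ _ ha' _ hb') _ he',
          hzero _ _ (by omega) _ ha' _ (hmem _ _ _ hb' _ he')]
      have ha1 : a.deg = 1 := by omega
      have hb1 : b.deg = 1 := by omega
      have he1 : e.deg = 1 := by omega
      rw [ha1] at ha'
      rw [hb1] at hb'
      rw [he1] at he'
      have hab := hmem 1 1 _ ha' _ hb'
      have hbe := hmem 1 1 _ hb' _ he'
      rw [← sub_eq_zero]
      apply hinj
      · exact Submodule.sub_mem _ (hmem 2 1 _ hab _ he') (hmem 1 2 _ ha' _ hbe)
      · rw [hcomm12 _ he' _ hab, map_sub, h12 _ he' _ hab, h12 _ ha' _ hbe, h11 _ ha' _ hb',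
          h11 _ hb' _ he']
        simp only [map_sub, map_smul]
        rw [hcomm11 _ hb' _ he', hcomm11 _ ha' _ he']
        simp only [smul_neg, sub_eq_add_neg, neg_add, neg_neg]
        abel
    intro x y w
    have h1 : ∀ a b, M (M (bas R a) (bas R b)) w = M (bas R a) (M (bas R b) w) := fun a b =>
      LinearMap.congr_fun (f := M (M (bas R a) (bas R b))) (g := M (bas R a) ∘ₗ M (bas R b))
        (hom_ext_bas fun e => hbas a b e) w
    have h2 : ∀ a, M (M (bas R a) y) w = M (bas R a) (M y w) := fun a =>
      LinearMap.congr_fun (f := M.flip w ∘ₗ M (bas R a)) (g := M (bas R a) ∘ₗ M.flip w)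
        (hom_ext_bas fun b => h1 a b) y
    exact LinearMap.congr_fun (f := M.flip w ∘ₗ M.flip y) (g := M.flip (M y w))
      (hom_ext_bas fun a => h2 a) x
  refine ⟨M, ⟨hd.toIsGradedComplex, hd.one_mem, hmem, hone, hone', hassoc, hcomm, ?_, ?_⟩, hMp⟩
  · intro i hi x hx
    by_cases h1 : i = 1
    · subst h1
      -- Anticommutativity alone gives only 2x² = 0. Squares of basis elements vanish by assumption,
      -- and cross terms cancel; membership is carried along for that purpose.
      refine (piece_induction (p := fun x => x ∈ piece R m t 1 ∧ M x x = 0) ?_ ?_ ?_ ?_ hx).2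
      · exact fun a ha => ⟨bas_mem_piece ha, by rw [hMp a a ha ha, hp_self a ha]⟩
      · exact ⟨Submodule.zero_mem _, by simp⟩
      · rintro x y ⟨hx, hxx⟩ ⟨hy, hyy⟩
        refine ⟨Submodule.add_mem _ hx hy, ?_⟩
        simp only [map_add, LinearMap.add_apply]
        rw [hxx, hyy, hcomm11 x hx y hy]
        simp
      · rintro r x ⟨hx, hxx⟩
        refine ⟨Submodule.smul_mem _ _ hx, ?_⟩
        simp only [map_smul, LinearMap.smul_apply, hxx, smul_zero]
    · have : 3 < i + i := by
        obtain ⟨k, rfl⟩ := hi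
        omega
      exact hzero i i this x hx x hx
  · intro i x hx y
    have : d ∘ₗ M x = M (d x) + (-1 : R) ^ i • (M x ∘ₗ d) := hom_ext_bas fun b => by
      simpa using hleib i b.deg x hx (bas R b) (bas_mem_piece rfl)
    simpa using congrArg (fun f => f y) this

end DGAlgebra

/-! ### Explicit products and their boundaries -/

section Products

variable {R : Type*} [CommRing R] {m t : ℕ}

/-- The element of degree two with given coordinates. -/
noncomputable def ofCoordTwo (φ : Fin m → R) (ψ : Low m t → Pair → R) : Res R m t :=
  ∑ r, φ r • bas R (.f r) + ∑ k : Low m t, ∑ p : Pair, ψ k p • bas R (.v k p)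

lemma ofCoordTwo_eq (φ : Fin m → R) (ψ : Low m t → Pair → R) :
    ofCoordTwo φ ψ = ofCoord fun b => match b with
      | .f i => φ i
      | .v k p => ψ k p
      | _ => 0 := by
  classical
  ext b
  cases b <;> simp [ofCoordTwo, bas_apply, ite_and]

lemma ofCoordTwo_f (φ : Fin m → R) (ψ : Low m t → Pair → R) (i : Fin m) :
    ofCoordTwo φ ψ (.f i) = φ i := by rw [ofCoordTwo_eq]; rfl

lemma ofCoordTwo_v (φ : Fin m → R) (ψ : Low m t → Pair → R) (k : Low m t) (p : Pair) :
    ofCoordTwo φ ψ (.v k p) = ψ k p := by rw [ofCoordTwo_eq]; rfl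

lemma ofCoordTwo_mem (φ : Fin m → R) (ψ : Low m t → Pair → R) :
    ofCoordTwo φ ψ ∈ piece R m t 2 := by
  rw [ofCoordTwo_eq, mem_piece]
  intro b hb
  cases b <;> simp [Cell.deg] at hb ⊢

variable (T : Matrix (Fin m) (Fin m) R) (c : Fin m → Fin m → Fin 3 → R) (z : Fin 3 → R)

lemma diff_ofCoordTwo_eq (φ : Fin m → R) (ψ : Low m t → Pair → R) (y : Res R m t)
    (hy : y ∈ piece R m t 1) (he : ∀ j : High m t, ∑ i, T j i * φ i = y (.e j))
    (hu : ∀ (k : Low m t) l,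
      ∑ p, ψ k p * koszulTwo z p l - ∑ i, c i k l * φ i = y (.u k l)) :
    diff T c z t (ofCoordTwo φ ψ) = y := by
  have h := mem_piece.1 (diff_mem_piece T c z 1 _ (ofCoordTwo_mem φ ψ))
  have hy' := mem_piece.1 hy
  ext b
  by_cases hb : b.deg = 1
  · cases b <;> simp only [Cell.deg] at hb
    · omega
    · rw [diff_apply_e, ← he]; simp only [ofCoordTwo_f]
    · rw [diff_apply_u, ← hu]; simp only [ofCoordTwo_f, ofCoordTwo_v]
    all_goals omega
  · rw [h b hb, hy' b hb]

lemma low_ne_high (k : Low m t) (i : High m t) : (k : Fin m) ≠ i := fun h => by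
  have h1 := k.2
  have h2 := i.2
  rw [h] at h1
  omega

/-- The product of `e i` and `e j`. -/
noncomputable def mulEE (t : ℕ) (i j : Fin m) : Res R m t :=
  ofCoordTwo (triple T i j) fun k p => dThree T c k i j p.1.1 p.1.2

/-- The product of `e j` and `u i l`. -/
noncomputable def mulEU (t : ℕ) (i j : Fin m) (l : Fin 3) : Res R m t :=
  ofCoordTwo (fun r => z l * triple T i j r) fun k p => dFour T c z k i j l p.1.1 p.1.2

/-- The product of `u k l` and `u k l'` up to the factor `-gen T k`. -/
noncomputable def koszulMul (R : Type*) [CommRing R] (k : Low m t) (l l' : Fin 3) : Res R m t :=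
  ofCoordTwo 0 fun k' p => if k' = k then
    (if p.1 = (l, l') then 1 else 0) - (if p.1 = (l', l) then 1 else 0) else 0

lemma diff_koszulMul (k : Low m t) (l l' : Fin 3) : diff T c z t (koszulMul R k l l') =
    z l • bas R (.u k l') - z l' • bas R (.u k l) := by
  classical
  refine diff_ofCoordTwo_eq T c z _ _ _ (Submodule.sub_mem _ (Submodule.smul_mem _ _
    (bas_mem_piece rfl)) (Submodule.smul_mem _ _ (bas_mem_piece rfl))) ?_ ?_
  · intro j
    simp [bas_apply]
  · intro k' l''
    by_cases h : k = k'
    · subst h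
      rw [sum_pair]
      fin_cases l <;> fin_cases l' <;> fin_cases l'' <;> simp [bas_apply, koszulTwo]
    · simp [bas_apply, h, Ne.symm h]

lemma koszulMul_self (k : Low m t) (l : Fin 3) : koszulMul R k l l = 0 := by
  rw [koszulMul, ofCoordTwo_eq]
  ext b
  cases b <;> simp

lemma koszulMul_swap (k : Low m t) (l l' : Fin 3) :
    koszulMul R k l l' = -koszulMul R k l' l := by
  rw [koszulMul, koszulMul, ofCoordTwo_eq, ofCoordTwo_eq]
  ext b
  cases b <;> simp
  split_ifs <;> simp

variable (hskew : ∀ i j, T j i = -T i j) (hdiag : ∀ i, T i i = 0)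
  (hc : ∀ i j, T j i = ∑ l, c i j l * z l) (hc0 : ∀ k : Low m t, ∀ l, c k k l = 0)

include hskew hdiag in
lemma mulEE_self (i : Fin m) : mulEE T c t i i = 0 := by
  rw [mulEE, ofCoordTwo_eq]
  ext b
  cases b <;> simp [triple_self T hskew hdiag, dThree_self T hskew hdiag]

include hskew hdiag in
lemma mulEE_swap (i j : Fin m) : mulEE T c t i j = -mulEE T c t j i := by
  rw [mulEE, mulEE, ofCoordTwo_eq, ofCoordTwo_eq]
  ext b
  cases b <;> simp [triple_swap T hskew hdiag i j, dThree_swap T hskew hdiag c _ i j]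

include hskew hdiag hc hc0 in
lemma diff_mulEE (i j : High m t) : diff T c z t (mulEE T c t i j) =
    gen T i • bas R (.e j) - gen T j • bas R (.e i) := by
  classical
  refine diff_ofCoordTwo_eq T c z _ _ _ (Submodule.sub_mem _ (Submodule.smul_mem _ _
    (bas_mem_piece rfl)) (Submodule.smul_mem _ _ (bas_mem_piece rfl))) ?_ ?_
  · intro s
    have := sum_triple_mul_row T hskew hdiag i j s
    simp only [mul_comm] at this ⊢
    rw [this]
    simp [bas_apply, Subtype.ext_iff, eq_comm]
  · intro k l
    rw [sum_mul_koszulTwo (dThree T c k i j) (dThree_pair_self T hskew hdiag c k i j)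
      (dThree_swap_pair T hskew hdiag c k i j),
      sum_mul_dThree T hskew hdiag c z hc (hc0 k) (low_ne_high k i) (low_ne_high k j)]
    simp [bas_apply, mul_comm]

include hskew hdiag hc hc0 in
lemma diff_mulEU (i : Low m t) (j : High m t) (l : Fin 3) : diff T c z t (mulEU T c z t i j l) =
    gen T j • bas R (.u i l) + (gen T i * z l) • bas R (.e j) := by
  classical
  refine diff_ofCoordTwo_eq T c z _ _ _ (Submodule.add_mem _ (Submodule.smul_mem _ _
    (bas_mem_piece rfl)) (Submodule.smul_mem _ _ (bas_mem_piece rfl))) ?_ ?_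
  · intro s
    have h1 : ∑ r, T s r * (z l * triple T i j r) = z l * ∑ r, triple T i j r * T s r := by
      rw [Finset.mul_sum]
      exact Finset.sum_congr rfl fun r _ => by ring
    rw [h1, sum_triple_mul_row T hskew hdiag i j s, if_neg (low_ne_high i s).symm]
    simp [bas_apply, Subtype.ext_iff, eq_comm, mul_comm]
  · intro k l'
    have h1 : ∑ r, c r k l' * (z l * triple T i j r) = z l * ∑ r, triple T i j r * c r k l' := by
      rw [Finset.mul_sum]
      exact Finset.sum_congr rfl fun r _ => by ring
    rw [h1]
    by_cases hk : k = i
    · subst hk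
      -- In the block k = i the constants are the coordinates of ε_l ∧ D, with ε_l the l-th unit
      -- vector. Its Koszul boundary has l'-coordinate z_l D_{l'}, less ∑ z_α D_α if l = l'; the
      -- first term cancels the f-part, and ∑ z_α D_α = -y_j.
      set D : Fin 3 → R := fun β => coPf T hskew hdiag
        [col c k β, Pi.single (j : Fin m) 1, Pi.single (k : Fin m) 1] with hD
      have hA : ∀ p : Pair, dFour T c z k k j l p.1.1 p.1.2 =
          (if l = p.1.1 then D p.1.2 else 0) - if l = p.1.2 then D p.1.1 else 0 := by
        rintro ⟨⟨α, β⟩, h⟩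
        rw [dFour_self T hskew hdiag]
        by_cases h1 : l = α
        · subst h1
          have : l ≠ β := ne_of_lt h
          simp [this, hD]
        · have hne : β ≠ α := ne_of_gt h
          by_cases h2 : l = β <;> simp [h1, h2, hD, hne]
      simp only [hA]
      rw [sum_mul_koszulTwo (fun α β => (if l = α then D β else 0) - if l = β then D α else 0)
        (by simp) (by simp)]
      have h2 := sum_mul_coPf_col_self T hskew hdiag c z hc (low_ne_high k j)
      have h3 : ∑ r, triple T k j r * c r k l' = D l' :=
        sum_triple_mul T hskew hdiag k j (col c k l')
      rw [h3]
      simp only [mul_sub, Finset.sum_sub_distrib, mul_ite, mul_zero, Finset.sum_ite_eq,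
        Finset.mem_univ, if_true]
      by_cases hl : l = l'
      · subst hl
        simp only [if_true]
        change z l * D l - (∑ α, z α * D α) - _ = _
        rw [h2]
        simp [bas_apply]
      · simp [bas_apply, hl]
    · have h2 : ∑ p : Pair, dFour T c z k i j l p.1.1 p.1.2 * koszulTwo z p l' =
          z l * ∑ p : Pair, dThree T c k i j p.1.1 p.1.2 * koszulTwo z p l' := by
        rw [Finset.mul_sum]
        refine Finset.sum_congr rfl fun p _ => ?_
        rw [dFour_of_ne T c z (fun h => hk (Subtype.ext h)), mul_assoc]
      rw [h2, sum_mul_koszulTwo (dThree T c k i j) (dThree_pair_self T hskew hdiag c k i j)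
        (dThree_swap_pair T hskew hdiag c k i j),
        sum_mul_dThree T hskew hdiag c z hc (hc0 k) (fun h => hk (Subtype.ext h)) (low_ne_high k j)]
      simp [bas_apply, Ne.symm hk]

lemma coPf_five_swap_outer (a b d e f : Fin m → R) :
    coPf T hskew hdiag [a, b, d, e, f] = -coPf T hskew hdiag [d, b, a, e, f] := by
  rw [coPf_five_swap_zero, coPf_five_swap_one, coPf_five_swap_zero, neg_neg]

include hskew hdiag in
-- The value alternates in the three columns γ, α, β, so only the γ completing the pair contributes.
-- The sign of the resulting permutation of 0, 1, 2 is that of the coordinate of ∂w^k.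
lemma sum_mul_coPf_five_col (k i : Fin m) (p : Pair) :
    ∑ γ, z γ * coPf T hskew hdiag [col c k γ, Pi.single k 1, col c k p.1.1, col c k p.1.2,
      Pi.single i 1] = (∑ r, c r k 2 * dThree T c k i r 0 1) * koszulThree z p := by
  rw [sum_col_mul_dThree T hskew hdiag]
  have hz1 : ∀ a e : Fin m → R, coPf T hskew hdiag [a, Pi.single k 1, a, e, Pi.single i 1] = 0 :=
    fun a e => coPf_of_not_nodup _ _ _ _ (by simp)
  have hz2 : ∀ a e : Fin m → R, coPf T hskew hdiag [a, Pi.single k 1, e, a, Pi.single i 1] = 0 :=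
    fun a e => coPf_of_not_nodup _ _ _ _ (by simp)
  obtain ⟨⟨α, β⟩, h⟩ := p
  rw [Fin.sum_univ_three]
  fin_cases α <;> fin_cases β <;>
    first
    | exact absurd h (by decide)
    | simp only [Fin.zero_eta, Fin.mk_one, Fin.reduceFinMk, hz1, hz2, mul_zero, zero_add, add_zero,
        koszulThree]
  · rw [coPf_five_swap_outer, coPf_five_swap_two]
    simp [mul_comm]
  · rw [coPf_five_swap_outer]
    simp [mul_comm]
  · simp [mul_comm]

/-- The product of `e i` and `f j`. -/
noncomputable def mulEF (t : ℕ) (i j : Fin m) : Res R m t :=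
  ofCoord fun b => match b with
    | .g => if i = j then 1 else 0
    | .w k => if j = k then ∑ r, c r k 2 * dThree T c k i r 0 1 else 0
    | _ => 0

lemma mulEF_mem (i j : Fin m) : mulEF T c t i j ∈ piece R m t 3 := by
  rw [mulEF, mem_piece]
  intro b hb
  cases b <;> simp [Cell.deg] at hb ⊢

include hskew hdiag hc hc0 in
-- The right side is y_i f_j - e_i ∂f_j with formulas (a) and (b) inserted, the boundary that the
-- Leibniz rule requires of e_i f_j.
lemma diff_mulEF (i : High m t) (j : Fin m) : diff T c z t (mulEF T c t i j) =
    gen T i • bas R (.f j) - (∑ s : High m t, T s j • mulEE T c t i s -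
      ∑ k : Low m t, ∑ l, c j k l • mulEU T c z t k i l) := by
  classical
  -- The e-terms and the u-terms of ∂f_j, the latter weighted by z, recombine into a sum over all
  -- rows.
  have hsum : ∀ (F : Fin m → R),
      ∑ s : High m t, T s j * F s + ∑ k : Low m t, T k j * F k = -∑ s, T j s * F s := by
    intro F
    rw [add_comm, sum_low_add_sum_high (t := t) fun s => T s j * F s, ← Finset.sum_neg_distrib]
    exact Finset.sum_congr rfl fun s _ => by rw [hskew j s]; ring
  ext b
  simp only [Finsupp.sub_apply, Finsupp.smul_apply, Finsupp.finsetSum_apply, smul_eq_mul]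
  cases b with
  | f q =>
    rw [diff_apply_f]
    simp only [mulEE, mulEU, ofCoordTwo_f, mulEF, ofCoord_apply]
    have h1 : ∑ k : Low m t, ∑ l, c j k l * (z l * triple T k i q) =
        -∑ k : Low m t, T k j * triple T i k q := by
      rw [← Finset.sum_neg_distrib]
      refine Finset.sum_congr rfl fun k _ => ?_
      rw [hc j k, Finset.sum_mul, ← Finset.sum_neg_distrib]
      exact Finset.sum_congr rfl fun l _ => by rw [triple_swap T hskew hdiag k i]; ring
    rw [h1, sub_neg_eq_add, hsum (fun s => triple T i s q)]
    have h2 : ∑ s, T j s * triple T i s q = ∑ s, triple T q i s * T j s :=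
      Finset.sum_congr rfl fun s _ => by
        rw [triple_cycle T hskew hdiag q i s, mul_comm]
    rw [h2, sum_triple_mul_row T hskew hdiag]
    by_cases h3 : (i : Fin m) = j <;> by_cases h4 : j = q <;>
      simp [bas_apply, h3, h4, eq_comm]
    exact fun h => absurd h.symm h3
  | v k p =>
    rw [diff_apply_v]
    simp only [mulEE, mulEU, ofCoordTwo_v, mulEF, ofCoord_apply]
    set D : Fin 3 → R := fun β => coPf T hskew hdiag
        [col c k β, Pi.single (i : Fin m) 1, Pi.single (k : Fin m) 1] with hD
    -- For k' ≠ k the factor z_l contracts c to T. For k' = k the exceptional constants give two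
    -- further terms, while the d^{k,i,k} term is zero; these are the extra terms of
    -- `sum_mul_dThree_add`.
    have h1 : ∀ k' : Low m t, ∑ l, c j k' l * dFour T c z k k' i l p.1.1 p.1.2 =
        -(T k' j * dThree T c k i k' p.1.1 p.1.2) +
          if k' = k then c j k p.1.1 * D p.1.2 - c j k p.1.2 * D p.1.1 else 0 := by
      intro k'
      by_cases hk : k' = k
      · subst hk
        rw [dThree_right T hskew hdiag, if_pos rfl]
        obtain ⟨⟨α, β⟩, h⟩ := p
        have hαβ : α ≠ β := ne_of_lt h
        simp only [dFour_self T hskew hdiag]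
        have h2 : ∀ l, (c j k' l * if l = α then D β else if l = β then -D α else 0) =
            (if l = α then c j k' l * D β else 0) - if l = β then c j k' l * D α else 0 := by
          intro l
          by_cases h1 : l = α
          · subst h1; simp [hαβ]
          · by_cases h2 : l = β <;> simp [h1, h2, hαβ.symm]
        change ∑ l, (c j k' l * if l = α then D β else if l = β then -D α else 0) = _
        simp [h2, Finset.sum_sub_distrib]
      · rw [if_neg hk, add_zero, hc j k', Finset.sum_mul, ← Finset.sum_neg_distrib]
        refine Finset.sum_congr rfl fun l _ => ?_
        rw [dFour_of_ne T c z (fun h => hk (Subtype.ext h.symm)), dThree_swap T hskew hdiag]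
        ring
    simp only [h1, Finset.sum_add_distrib, Finset.sum_neg_distrib, Finset.sum_ite_eq',
      Finset.mem_univ, if_true]
    have h2 := sum_mul_dThree_add T hskew hdiag c z hc (j := j) (hc0 k) (low_ne_high k i)
      p.1.1 p.1.2
    rw [sum_mul_coPf_five_col T c z hskew hdiag] at h2
    have h3 := hsum (fun s => dThree T c k i s p.1.1 p.1.2)
    change (∑ s, T j s * dThree T c k i s p.1.1 p.1.2) + c j k p.1.1 * D p.1.2
      - c j k p.1.2 * D p.1.1 = _ at h2
    have h4 : (bas R (.f j : Cell m t)) (.v k p) = 0 := by simp [bas_apply]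
    rw [h4]
    simp only [ite_mul, one_mul, zero_mul]
    rw [← h2]
    linear_combination h3
  | one => rw [diff_apply_one]; simp [mulEE, mulEU, ofCoordTwo_eq, mulEF, bas_apply]
  | e j => rw [diff_apply_e]; simp [mulEE, mulEU, ofCoordTwo_eq, mulEF, bas_apply]
  | u k l => rw [diff_apply_u]; simp [mulEE, mulEU, ofCoordTwo_eq, mulEF, bas_apply]
  | g => rw [diff_apply_g]; simp [mulEE, mulEU, ofCoordTwo_eq, bas_apply]
  | w k => rw [diff_apply_w]; simp [mulEE, mulEU, ofCoordTwo_eq, bas_apply]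

end Products

/-! ### Assembly of the DG algebra -/

section Main

variable {R : Type*} [CommRing R] {m t : ℕ}
variable (T : Matrix (Fin m) (Fin m) R) (c : Fin m → Fin m → Fin 3 → R) (z : Fin 3 → R)

/-- The coefficients of `∂` in degree one. -/
def diffOne : Cell m t → R
  | .e i => gen T i
  | .u k l => -(gen T k * z l)
  | _ => 0

lemma diff_bas_of_deg_one (a : Cell m t) (ha : a.deg = 1) :
    diff T c z t (bas R a) = diffOne T z a • bas R .one := by
  cases a <;> simp only [Cell.deg] at ha
  · omega
  · exact diff_e ..
  · exact diff_u ..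
  all_goals omega

/-- The products of basis elements of degree one, given those of the `u k l` and the `u k' l'` with
`k < k'`. -/
noncomputable def mulOne (Q : Low m t → Fin 3 → Low m t → Fin 3 → Res R m t) :
    Cell m t → Cell m t → Res R m t
  | .e i, .e j => mulEE T c t i j
  | .e j, .u i l => mulEU T c z t i j l
  | .u i l, .e j => -mulEU T c z t i j l
  | .u k l, .u k' l' => if k < k' then Q k l k' l' else if k' < k then -Q k' l' k l
      else -gen T k • koszulMul R k l l'
  | _, _ => 0

variable (hskew : ∀ i j, T j i = -T i j) (hdiag : ∀ i, T i i = 0)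
  (hc : ∀ i j, T j i = ∑ l, c i j l * z l) (hc0 : ∀ k : Low m t, ∀ l, c k k l = 0)
  (hz : HasRegularTriple (Ideal.span (Set.range z))) (hI : HasRegularTriple (pfIdeal T))

include hskew hdiag hc hc0 hz hI in
theorem exists_isDGAlgebra_diff : ∃ mul : Res R m t →ₗ[R] Res R m t →ₗ[R] Res R m t,
    IsDGAlgebra (piece R m t) (diff T c z t) (bas R .one) mul ∧
    (∀ i j : High m t, mul (bas R (.e i)) (bas R (.e j)) = mulEE T c t i j) ∧
    (∀ (i : Low m t) (j : High m t) (l : Fin 3),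
      mul (bas R (.e j)) (bas R (.u i l)) = mulEU T c z t i j l) ∧
    ∀ (i : High m t) (j : Fin m), mul (bas R (.e i)) (bas R (.f j)) = mulEF T c t i j := by
  have hres := isFreeResolution_diff T c z hskew hdiag hc hc0 hz hI
  -- For u's in different blocks any lift will do: it is used for k < k' and negated for k' < k.
  -- Within one block `koszulMul` is used, so that squares are zero on the nose.
  have hQ : ∀ (k : Low m t) (l : Fin 3) (k' : Low m t) (l' : Fin 3), ∃ q ∈ piece R m t 2,
      diff T c z t q = diffOne T z (.u k l) • bas R (.u k' l') -
        diffOne T z (.u k' l') • bas R (.u k l) := by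
    intro k l k' l'
    refine hres.exact_succ 0 _ (Submodule.sub_mem _ (Submodule.smul_mem _ _
      (bas_mem_piece rfl)) (Submodule.smul_mem _ _ (bas_mem_piece rfl))) ?_
    rw [map_sub, map_smul, map_smul, diff_bas_of_deg_one T c z _ rfl,
      diff_bas_of_deg_one T c z _ rfl, smul_smul, smul_smul, mul_comm, sub_self]
  choose Q hQ_mem hQ_d using hQ
  have h_mem : ∀ a b : Cell m t, a.deg = 1 → b.deg = 1 → mulOne T c z Q a b ∈ piece R m t 2 := by
    intro a b ha hb
    cases a <;> simp only [Cell.deg] at ha <;> first | omega | skip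
    all_goals cases b <;> simp only [Cell.deg] at hb <;> first | omega | skip
    · exact ofCoordTwo_mem _ _
    · exact ofCoordTwo_mem _ _
    · exact Submodule.neg_mem _ (ofCoordTwo_mem _ _)
    · rw [mulOne]
      split_ifs
      · exact hQ_mem ..
      · exact Submodule.neg_mem _ (hQ_mem ..)
      · exact Submodule.smul_mem _ _ (ofCoordTwo_mem _ _)
  have h_self : ∀ a : Cell m t, a.deg = 1 → mulOne T c z Q a a = 0 := by
    intro a ha
    cases a <;> simp only [Cell.deg] at ha <;> first | omega | skip
    · exact mulEE_self T c hskew hdiag _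
    · simp [mulOne, koszulMul_self]
  have h_swap : ∀ a b : Cell m t, a.deg = 1 → b.deg = 1 →
      mulOne T c z Q a b = -mulOne T c z Q b a := by
    intro a b ha hb
    cases a <;> simp only [Cell.deg] at ha <;> first | omega | skip
    all_goals cases b <;> simp only [Cell.deg] at hb <;> first | omega | skip
    · exact mulEE_swap T c hskew hdiag _ _
    · exact (neg_neg _).symm
    · rfl
    · rename_i k l k' l'
      simp only [mulOne]
      rcases lt_trichotomy k k' with h | rfl | h
      · simp [h, h.not_gt]
      · simp [koszulMul_swap k l l']
      · simp [h, h.not_gt]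
  have h_d : ∀ a b : Cell m t, a.deg = 1 → b.deg = 1 → diff T c z t (mulOne T c z Q a b) =
      diffOne T z a • bas R b - diffOne T z b • bas R a := by
    intro a b ha hb
    cases a <;> simp only [Cell.deg] at ha <;> first | omega | skip
    all_goals cases b <;> simp only [Cell.deg] at hb <;> first | omega | skip
    · exact diff_mulEE T c z hskew hdiag hc hc0 _ _
    · rw [mulOne, diff_mulEU T c z hskew hdiag hc hc0]
      simp [diffOne]
    · rw [mulOne, map_neg, diff_mulEU T c z hskew hdiag hc hc0]
      simp only [diffOne, neg_smul]
      abel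
    · rename_i k l k' l'
      simp only [mulOne]
      rcases lt_trichotomy k k' with h | rfl | h
      · rw [if_pos h, hQ_d]
      · rw [if_neg (lt_irrefl _), if_neg (lt_irrefl _), map_smul, diff_koszulMul]
        simp only [diffOne, smul_sub, smul_smul, neg_mul]
      · rw [if_neg h.not_gt, if_pos h, map_neg, hQ_d, neg_sub]
  obtain ⟨mul, hmul, hmul₁⟩ := exists_isDGAlgebra hres (diffOne T z)
    (diff_bas_of_deg_one T c z) (mulOne T c z Q) h_mem h_self h_swap h_d
  have hEE : ∀ i j : High m t, mul (bas R (.e i)) (bas R (.e j)) = mulEE T c t i j :=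
    fun i j => hmul₁ _ _ rfl rfl
  have hEU : ∀ (i : Low m t) (j : High m t) (l : Fin 3),
      mul (bas R (.e j)) (bas R (.u i l)) = mulEU T c z t i j l := fun i j l => hmul₁ _ _ rfl rfl
  refine ⟨mul, hmul, hEE, hEU, fun i j => ?_⟩
  -- No choice is left for e_i f_j: both sides have the same boundary and ∂₃ is injective.
  rw [← sub_eq_zero]
  apply diff_injective_three T c z hz hI
  · exact Submodule.sub_mem _ (hmul.mul_mem 1 2 _ (bas_mem_piece rfl) _ (bas_mem_piece rfl))
      (mulEF_mem T c _ _)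
  · rw [map_sub, hmul.leibniz 1 _ (bas_mem_piece rfl), diff_mulEF T c z hskew hdiag hc hc0, diff_e,
      map_smul, LinearMap.smul_apply, hmul.one_mul, diff_f]
    simp only [map_sub, map_sum, map_smul, hEE, hEU, pow_one, neg_smul, one_smul]
    abel

end Main

end PfTrim

theorem mainTheorem5 {R : Type*} [CommRing R] (𝔪 : Ideal R) (hR : IsBaseRing 𝔪)
    (z : Fin 3 → R) (hz : Ideal.span (Set.range z) = 𝔪)
    {m : ℕ} (hm : Odd m) (T : Matrix (Fin m) (Fin m) R)
    (hskew : ∀ i j, T j i = -T i j) (hdiag : ∀ i, T i i = 0)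
    (hgrade : idealGrade (pfIdeal T) = 3)
    (t : ℕ) (ht : 1 ≤ t) (htm : t ≤ m)
    (c : Fin m → Fin m → Fin 3 → R) (hc : ∀ i j, T j i = ∑ l, c i j l * z l)
    (hc0 : ∀ k : Low m t, ∀ l, c k k l = 0) :
    IsFreeResolution (piece R m t) (diff T c z t) (bas R .one) (trimIdeal T 𝔪 t) ∧
    ∃ mul : Res R m t →ₗ[R] Res R m t →ₗ[R] Res R m t,
      IsDGAlgebra (piece R m t) (diff T c z t) (bas R .one) mul ∧
      (∀ i j : High m t, mul (bas R (.e i)) (bas R (.e j)) =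
        prodEE T t i j + ∑ k : Low m t, ∑ p : Pair,
          dThree T c k i j p.1.1 p.1.2 • bas R (.v k p)) ∧
      (∀ (i : Low m t) (j : High m t) (l : Fin 3),
        mul (bas R (.e j)) (bas R (.u i l)) =
          z l • prodEE T t i j + ∑ k : Low m t, ∑ p : Pair,
            dFour T c z k i j l p.1.1 p.1.2 • bas R (.v k p)) ∧
      (∀ i j : High m t, mul (bas R (.e i)) (bas R (.f j)) = prodEF R t i j) ∧
      (∀ (i : High m t) (j : Low m t), mul (bas R (.e i)) (bas R (.f j)) =
        (∑ r : Fin m, c r j 2 * dThree T c j i r 0 1) • bas R (.w j)) := by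
  classical
  subst hz
  have hI : HasRegularTriple (pfIdeal T) := hasRegularTriple_of_idealGrade hgrade.ge
  have hT : ∀ i j, T i j ∈ Ideal.span (Set.range z) := fun i j => by
    rw [hc j i]
    exact Ideal.sum_mem _ fun l _ => Ideal.mul_mem_left _ _ (Ideal.subset_span ⟨l, rfl⟩)
  -- A regular triple in I also lies in 𝔪 = (z), which makes the Koszul complex on z exact.
  have hz := hI.mono (pfIdeal_le T hT hm hgrade)
  refine ⟨isFreeResolution_diff T c z hskew hdiag hc hc0 hz hI, ?_⟩
  obtain ⟨mul, hmul, hEE, hEU, hEF⟩ :=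
    exists_isDGAlgebra_diff T c z hskew hdiag hc hc0 hz hI
  refine ⟨mul, hmul, hEE, ?_, ?_, ?_⟩
  · intro i j l
    rw [hEU, mulEU, ofCoordTwo, prodEE, Finset.smul_sum]
    simp only [smul_smul]
    rfl
  · intro i j
    rw [hEF, mulEF, prodEF]
    ext b
    have h : ∀ k : Low m t, ¬ (j : Fin m) = k := fun k => (low_ne_high k j).symm
    by_cases hij : (i : Fin m) = j <;> cases b <;> simp [bas_apply, hij, h]
  · intro i j
    rw [hEF, mulEF]
    have h : ¬ (i : Fin m) = j := (low_ne_high j i).symm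
    ext b
    cases b <;> simp [bas_apply, h]
    rename_i k
    by_cases hjk : j = k
    · subst hjk; simp
    · simp [hjk, Subtype.ext_iff.not.1 hjk]
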